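/- Let $(X,R,Y,R^\vee)$ be a reduced root datum with finite root set $R$ (for example that of a simply connected complex semisimple group $G\supset B\supset T$, with $X=X^*(T)$), with Weyl group $W$, simple roots $\Sigma$, positive roots $R^+$, length function $\ell$ and Bruhat order $<$ on $W$. Let $\lambda\in X$ be dominant. Put $\Sigma_\lambda=\{\alpha\in\Sigma:\langle\lambda,\alpha^\vee\rangle=0\}$, let $R^+_\lambda$ be the set of positive roots that are linear combinations of elements of $\Sigma_\lambda$, let $W_\lambda$ be the subgroup generated by the $s_\alpha$, $\alpha\in\Sigma_\lambda$, let $W^\lambda$ be the set of minimal length representatives of $W/W_\lambda$, and let $P_\lambda\supset B$ be the corresponding parabolic subgroup, so that $\dim G/P_\lambda=|R^+\setminus R^+_\lambda|$. The Hall–Littlewood polynomial is $$HL_\lambda(x;t)=\sum_{w\in W^\lambda}w\Bigl(x^\lambda\prod_{\alpha\in R^+\setminus R^+_\lambda}\frac{1-t\,x^{-\alpha}}{1-x^{-\alpha}}\Bigr),$$ an element of the field of fractions of $\mathbb Z[X][t]$, where $x^\mu$ ($\mu\in X$) is the basis of the group ring $\mathbb Z[X]$ and $w(x^\mu)=x^{w\mu}$,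 $w(t)=t$. For a root $\alpha$ and $k\in\mathbb Z$ let $H_{\alpha,k}=\{x\in \mathbb R\otimes X:\langle x,\alpha^\vee\rangle=k\}$. Alcoves are the connected components of the complement of all these hyperplanes, and the fundamental alcove is $\mathfrak A=\{x:0<\langle x,\alpha^\vee\rangle<1\ \text{for all}\ \alpha\in R^+\}$. Let $\Gamma=(-\beta_1,\dots,-\beta_l)$ be a reduced $(-\lambda)$-chain of roots with hyperplanes $H_{\beta_1,d_1},\dots,H_{\beta_l,d_l}$; that is, there is a sequence of alcoves $\mathfrak A=A_0,A_1,\dots,A_l=\mathfrak A+\lambda$, of minimal length among all sequences of successively adjacent alcoves from $\mathfrak A$ to $\mathfrak A+\lambda$, such that the common wall of $A_{j-1}$ and $A_j$ lies on $H_{\beta_j,d_j}$ and $\beta_j$ points from $A_{j-1}$ to $A_j$. For $J=\{j_1<\dots<j_t\}\subset\{1,\dots,l\}$ let $\hat r_{J_<}=\hat r_{j_1}\cdots\hat r_{j_t}$, where $\hat r_j(\mu)=s_{\beta_j}(\mu)+d_j\beta_j$, and for $u,w\in W$ write $u\xrightarrow{J_<}w$ if $u<us_{\beta_{j_1}}<us_{\beta_{j_1}}s_{\beta_{j_2}}<\dots<us_{\beta_{j_1}}\cdots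 s_{\beta_{j_t}}=w$. Let $\mathcal A^{op}(\Gamma)$ be the set of all triples $(u,J,w)$ with $u\in W$, $w\in W^\lambda$, $J\subset\{1,\dots,l\}$ and $u\xrightarrow{J_<}w$. Then for every $(u,J,w)\in\mathcal A^{op}(\Gamma)$ the number $2\dim G/P_\lambda-\ell(w)-\ell(u)-|J|$ is a nonnegative even integer, and $$HL_\lambda(x;t)=\sum_{(u,J,w)\in\mathcal A^{op}(\Gamma)}t^{\frac{2\dim G/P_\lambda-\ell(w)-\ell(u)-|J|}{2}}(1-t)^{|J|}\,x^{u\,\hat r_{J_<}(\lambda)}.$$ -/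

import Mathlib

noncomputable section

namespace HallLittlewood

variable {ι X Y : Type*} [AddCommGroup X] [AddCommGroup Y] (P : RootDatum ι X Y)

/-! ### Alcoves and chains of roots

The real vector space `𝔱*_ℝ = ℝ ⊗ X` is realized as the space `Y →+ ℝ` of additive maps on the
cocharacter lattice `Y`; the pairing of a point `x` with a coroot `α^∨` is `x α^∨`. -/

/-- A weight `μ ∈ X`, regarded as a point of `𝔱*_ℝ`. -/
def weightPoint (μ : X) : Y →+ ℝ :=
  (Int.castAddHom ℝ).comp (P.toLinearMap μ).toAddMonoidHom

/-- The affine hyperplane `H_{α,k} = {x | ⟨x, α^∨⟩ = k}`. -/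
def hyperplane (i : ι) (k : ℤ) : Set (Y →+ ℝ) := {x | x (P.coroot i) = k}

/-- The alcoves are the connected components of the complement of all hyperplanes `H_{α,k}`.
Since these components are convex, they are exactly the nonempty sets cut out by conditions
`k_α < ⟨x, α^∨⟩ < k_α + 1`, one for each root `α`, with integers `k_α`. -/
def IsAlcove (A : Set (Y →+ ℝ)) : Prop :=
  A.Nonempty ∧ ∃ k : ι → ℤ,
    A = {x : Y →+ ℝ | ∀ i, (k i : ℝ) < x (P.coroot i) ∧ x (P.coroot i) < k i + 1}

/-- The fundamental alcove: `0 < ⟨x, α^∨⟩ < 1` for all positive roots `α`. -/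
def fundamentalAlcove {P : RootDatum ι X Y} (b : P.Base) : Set (Y →+ ℝ) :=
  {x | ∀ i, b.IsPos i → 0 < x (P.coroot i) ∧ x (P.coroot i) < 1}

/-- The translate `A + μ` of a subset of `𝔱*_ℝ` by a weight. -/
def translate (A : Set (Y →+ ℝ)) (μ : X) : Set (Y →+ ℝ) :=
  (fun x ↦ x + weightPoint P μ) '' A

/-- `A` lies on the negative side and `B` on the positive side of `H_{α,k}`. -/
def PointsAcross (i : ι) (k : ℤ) (A B : Set (Y →+ ℝ)) : Prop :=
  (∀ x ∈ A, x (P.coroot i) < k) ∧ (∀ x ∈ B, (k : ℝ) < x (P.coroot i))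

/-- `A` and `B` lie on different sides of `H_{α,k}`. -/
def Separates (i : ι) (k : ℤ) (A B : Set (Y →+ ℝ)) : Prop :=
  PointsAcross P i k A B ∨ PointsAcross P i k B A

/-- `A —β→ B` through `H_{β,k}`: the alcoves `A` and `B` are adjacent, their common wall lies on
`H_{β,k}`, and `β` points from `A` to `B`. Two alcoves have a common wall on a hyperplane that
separates them if and only if they are separated by no other hyperplane. -/
def Crosses (i : ι) (k : ℤ) (A B : Set (Y →+ ℝ)) : Prop :=
  IsAlcove P A ∧ IsAlcove P B ∧ PointsAcross P i k A B ∧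
    ∀ (j : ι) (m : ℤ), Separates P j m A B → hyperplane P j m = hyperplane P i k

/-- An alcove path `A = A₀ —β₁→ A₁ —β₂→ ⋯ —β_l→ A_l = B` whose `j`-th step crosses
`H_{β_j,d_j}`. -/
def IsAlcovePath {l : ℕ} (β : Fin l → ι) (d : Fin l → ℤ) (A B : Set (Y →+ ℝ)) : Prop :=
  ∃ C : Fin (l + 1) → Set (Y →+ ℝ), C 0 = A ∧ C (Fin.last l) = B ∧
    ∀ j : Fin l, Crosses P (β j) (d j) (C j.castSucc) (C j.succ)

/-- The index of the root `-α_i`. -/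
def negIdx (i : ι) : ι := P.reflectionPerm i i

/-- `(γ_1, d_1), …, (γ_l, d_l)` is a `μ`-chain: there is an alcove path
`𝔄 = A₀ —(-γ₁)→ A₁ ⋯ —(-γ_l)→ A_l = 𝔄 - μ`, whose `j`-th step crosses `H_{-γ_j,d_j}`. -/
def IsChain {P : RootDatum ι X Y} (b : P.Base) (μ : X) {l : ℕ} (γ : Fin l → ι) (d : Fin l → ℤ) :
    Prop :=
  IsAlcovePath P (fun j ↦ negIdx P (γ j)) d (fundamentalAlcove b)
    (translate P (fundamentalAlcove b) (-μ))

/-- A `μ`-chain is reduced if its alcove path is of minimal length among all alcove paths with the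
same end points. -/
def IsReducedChain {P : RootDatum ι X Y} (b : P.Base) (μ : X) {l : ℕ} (γ : Fin l → ι)
    (d : Fin l → ℤ) : Prop :=
  IsChain b μ γ d ∧
    ∀ (l' : ℕ) (β' : Fin l' → ι) (d' : Fin l' → ℤ),
      IsAlcovePath P β' d' (fundamentalAlcove b) (translate P (fundamentalAlcove b) (-μ)) → l ≤ l'

/-! ### The Weyl group -/

/-- The Weyl group is finite: it acts faithfully on the roots. -/
theorem finite_weylGroup [Finite ι] : Finite P.weylGroup := by
  have := Fintype.ofFinite ι
  have hspan : ∀ g ∈ P.weylGroup, ∀ x : X, g • x - x ∈ P.rootSpan ℤ := by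
    intro g hg
    induction hg using RootPairing.weylGroup.induction with
    | mem i =>
      intro x
      rw [RootPairing.Equiv.reflection_smul, RootPairing.reflection_apply]
      have : P.root i ∈ P.rootSpan ℤ := Submodule.subset_span ⟨i, rfl⟩
      simpa using (P.rootSpan ℤ).smul_mem _ this
    | one => intro x; simp
    | mul g h _ _ hg hh =>
      intro x
      rw [mul_smul]
      simpa using add_mem (hg (h • x)) (hh x)
  have hker : ∀ g ∈ P.weylGroup, RootPairing.Equiv.indexHom P g = 1 → g = 1 := by
    intro g hg h1
    apply RootPairing.Equiv.weightHom_injective P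
    ext x
    rw [map_one, LinearEquiv.coe_one, id]
    change g • x = x
    rw [← sub_eq_zero]
    apply P.eq_zero_of_mem_rootSpan_of_rootForm_self_eq_zero (hspan g hg x)
    rw [RootPairing.rootForm_apply_apply]
    refine Finset.sum_eq_zero fun i _ ↦ ?_
    have e : P.toLinearMap (g • x) (P.coroot i) = P.toLinearMap x (P.coroot i) := by
      have h2 := LinearMap.congr_fun
        (RootPairing.Hom.weight_coweight_transpose_apply P P (P.coroot i) g.toHom) x
      have h3 := RootPairing.Hom.coroot_coweightMap_apply P P i g.toHom
      have h4 : g.toHom.indexEquiv.symm i = i := by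
        have : g.toHom.indexEquiv = 1 := h1
        rw [this]; rfl
      rw [h4] at h3
      rw [h3] at h2
      exact h2
    simp [RootPairing.coroot', e]
  let f : P.weylGroup →* (ι ≃ ι) := (RootPairing.Equiv.indexHom P).comp P.weylGroup.subtype
  have hf : Function.Injective f := by
    rw [injective_iff_map_eq_one]
    intro g hg
    exact Subtype.ext (hker g g.2 hg)
  exact Finite.of_injective f hf

instance [Finite ι] : Finite P.weylGroup := finite_weylGroup P

/-- The reflection `s_α`, as an element of the Weyl group. -/
abbrev refl (i : ι) : P.weylGroup := RootPairing.weylGroup.ofIdx P i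

variable {P} (b : P.Base)

/-- The length of `w`: the least length of an expression of `w` in the simple reflections. -/
def len (w : P.weylGroup) : ℕ :=
  sInf {n | ∃ s : List ι, (∀ i ∈ s, i ∈ b.support) ∧ s.length = n ∧ (s.map (refl P)).prod = w}

/-- The covering relation `u ⋖ u s_α`, `ℓ(u s_α) = ℓ(u) + 1`, of the Bruhat order. -/
def BruhatCovers (u v : P.weylGroup) : Prop :=
  ∃ i : ι, v = u * refl P i ∧ len b v = len b u + 1

/-- The strict Bruhat order. -/
def BruhatLT : P.weylGroup → P.weylGroup → Prop := Relation.TransGen (BruhatCovers b)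

/-- For a list of roots `β_1, …, β_t`: `u < u s_{β_1} < u s_{β_1} s_{β_2} < ⋯ < w`, where
`w = u s_{β_1} ⋯ s_{β_t}`. -/
def BruhatPath : P.weylGroup → List ι → P.weylGroup → Prop
  | u, [], w => u = w
  | u, i :: s, w => BruhatLT b u (u * refl P i) ∧ BruhatPath (u * refl P i) s w

/-- `Σ_λ`: the simple roots `α` with `⟨λ, α^∨⟩ = 0`. -/
def simpleStab (lam : X) : Set ι := {i | i ∈ b.support ∧ P.toLinearMap lam (P.coroot i) = 0}

/-- `W_λ`: the subgroup generated by the `s_α`, `α ∈ Σ_λ`. -/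
def stabGroup (lam : X) : Subgroup P.weylGroup := Subgroup.closure (refl P '' simpleStab b lam)

/-- `W^λ`: the representatives of minimal length of the cosets `w W_λ`. -/
def minReps (lam : X) : Set P.weylGroup :=
  {w | ∀ v ∈ stabGroup b lam, len b w ≤ len b (w * v)}

/-- `R⁺ ∖ R⁺_λ`: the positive roots that are not linear combinations of the roots in `Σ_λ`. -/
def outerRoots (lam : X) : Set ι :=
  {i | b.IsPos i ∧ P.root i ∉ Submodule.span ℤ (P.root '' simpleStab b lam)}

/-- `dim G/P_λ`: the tangent space of `G/P_λ` at the base point has as its weights the negatives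
of the roots in `R⁺ ∖ R⁺_λ`, each with multiplicity one. -/
def dimFlag (lam : X) : ℕ := (outerRoots b lam).ncard

/-! ### The Hall–Littlewood polynomial -/

theorem isDomain_groupRing [Module.Free ℤ X] : IsDomain (AddMonoidAlgebra ℤ X) := by
  have : TwoUniqueSums X := TwoUniqueSums.of_injective_addHom
    ((Module.Free.chooseBasis ℤ X).repr : X →+ (Module.Free.ChooseBasisIndex ℤ X →₀ ℤ)).toAddHom
    (Module.Free.chooseBasis ℤ X).repr.injective inferInstance
  have : NoZeroDivisors (AddMonoidAlgebra ℤ X) := inferInstance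
  exact NoZeroDivisors.to_isDomain _

instance [Module.Free ℤ X] : IsDomain (AddMonoidAlgebra ℤ X) := isDomain_groupRing

/-- The ring `ℤ[X][t]` of polynomials in `t` over the group ring of the weight lattice. -/
abbrev WeightRing (X : Type*) [AddCommGroup X] : Type _ := Polynomial (AddMonoidAlgebra ℤ X)

/-- The field of fractions of `ℤ[X][t]`. -/
abbrev WeightField (X : Type*) [AddCommGroup X] : Type _ := FractionRing (WeightRing X)

/-- The element `x^μ = e^μ`. -/
def expo (μ : X) : WeightRing X := Polynomial.C (AddMonoidAlgebra.single μ 1)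

/-- The action of `w` on `ℤ[X][t]`, with `x^μ ↦ x^{wμ}` and `t ↦ t`. -/
def actRing (w : P.weylGroup) : WeightRing X ≃+* WeightRing X :=
  Polynomial.mapEquiv
    (AddMonoidAlgebra.domCongr ℤ ℤ (DistribMulAction.toAddEquiv X w)).toRingEquiv

/-- The action of `w` on the field of fractions of `ℤ[X][t]`. -/
def actField (w : P.weylGroup) : WeightField X ≃+* WeightField X :=
  IsFractionRing.ringEquivOfRingEquiv (actRing w)

/-- The Hall–Littlewood polynomial
`∑_{w ∈ W^λ} w (x^λ ∏_{α ∈ R⁺ ∖ R⁺_λ} (1 - t x^{-α}) / (1 - x^{-α}))`,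
defined as an element of the field of fractions of `ℤ[X][t]`. -/
def hallLittlewood [Finite ι] [Module.Free ℤ X] (lam : X) : WeightField X :=
  ∑ w ∈ (Set.toFinite (minReps b lam)).toFinset,
    actField w (algebraMap (WeightRing X) (WeightField X) (expo lam) *
      ∏ i ∈ (Set.toFinite (outerRoots b lam)).toFinset,
        algebraMap (WeightRing X) (WeightField X) (1 - Polynomial.X * expo (-P.root i)) /
          algebraMap (WeightRing X) (WeightField X) (1 - expo (-P.root i)))

/-! ### The terms of the formula -/

variable (P) in
/-- The affine reflection in `H_{β,k}` on weights: `μ ↦ s_β(μ) + k β`. -/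
def affineRefl (i : ι) (k : ℤ) (μ : X) : X := P.reflection i μ + k • P.root i

variable (P) in
/-- `r̂_{J_<}(μ) = r̂_{j_1} ⋯ r̂_{j_t} (μ)` for `J = {j_1 < ⋯ < j_t}`, where `r̂_j` is the
reflection in `H_{β_j,d_j}`. -/
def rHat {l : ℕ} (β : Fin l → ι) (d : Fin l → ℤ) (J : Finset (Fin l)) (μ : X) : X :=
  (J.sort (· ≤ ·)).foldr (fun j ν ↦ affineRefl P (β j) (d j) ν) μ

/-- The set of triples `(u, J, w)` with `u ∈ W`, `w ∈ W^λ` and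
`u < u s_{β_{j_1}} < ⋯ < u s_{β_{j_1}} ⋯ s_{β_{j_t}} = w`, where `J = {j_1 < ⋯ < j_t}`. -/
def admissibleOp (lam : X) {l : ℕ} (β : Fin l → ι) :
    Set (P.weylGroup × Finset (Fin l) × P.weylGroup) :=
  {p | p.2.2 ∈ minReps b lam ∧ BruhatPath b p.1 ((p.2.1.sort (· ≤ ·)).map β) p.2.2}

/-- The exponent `(2 dim G/P_λ - ℓ(w) - ℓ(u) - |J|) / 2` of `t`. -/
def tExponent (lam : X) {l : ℕ} (p : P.weylGroup × Finset (Fin l) × P.weylGroup) : ℕ :=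
  (2 * dimFlag b lam - len b p.2.2 - len b p.1 - p.2.1.card) / 2

end HallLittlewood

end

/-!
The Weyl group acts on the field of fractions `K` of `ℤ[X][t]`. For a root `α` put
`c_α = (1 - t x^{-α}) / (1 - x^{-α})` and `g_α = (1 - t) / (1 - x^{-α})`. A family `f : W → K` is
*compatible* with the alcove `A` (`Compat`) if for each simple root `α` and each `w` with
`γ = w⁻¹ α` positive
`f (s_α w) = x^{k(γ) α} g_α f(w) + c_{-α} s_α(f(w))`,
where `k(γ)` is the floor of `⟨·, γ^∨⟩` on `A`. For the fundamental alcove all these floors vanish,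
and the recursion says that `f` is obtained from `f(1)` by Demazure–Lusztig operators; in particular
the constant family `1` is compatible with it (`compat_one`).

The operator of a wall crossing (`pathStep`) sends `f` to the family
`w ↦ f(w) + (1 - t) t^{(ℓ(w) - ℓ(w s_β) - 1)/2} x^{-d wβ} f(w s_β)`, where the second term occurs only
if `w s_β < w`: the wall is either crossed, or the path is folded at it. It turns families compatible
with one alcove into families compatible with the next (`Compat.pathStep`). The alcove `𝔄 + λ` only
differs from `𝔄` by the shift of all floors by `⟨λ, γ^∨⟩`, which is absorbed by the twist `x^{wλ}`
(`Compat.twist`). Hence `Φ f = (w ↦ x^{wλ} (pathProd f)(w))` preserves compatibility with `𝔄`, and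
it multiplies `f(1)` by `x^λ`. The `n`-th iterate of `Φ` on the constant family `1` is therefore a
compatible family `h n` with `h n 1 = x^{nλ}`. Expanding the product over the path shows that `h 1 w`
is the sum over the `(u, J)` with `u —J→ w` (`pathProd_one_eq_sum`).

It remains to identify `∑_{w ∈ W^λ} t^{dim - ℓ(w)} h 1 w` with `HL_λ`
(`hallLittlewood_eq_sum_compat`). For every compatible family with initial value `x^{nλ}` this sum is
`W`-invariant (`Compat.actField_sum_minReps`), and `h n w = ∑_v c_w(v) x^{n vλ}` with coefficients
independent of `n`, triangular for the length, and with `c_w(w)` a product of factors `c_α`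
(`exists_coeff`). The characters `n ↦ x^{nμ}` being linearly independent, the coefficients
of the sum at the weights `vλ` are permuted by `W`. So they are all determined by the one at the
longest element of `W^λ`, to which only its own summand contributes. This yields the product of the
`c_α`, `α ∈ R⁺ ∖ R⁺_λ`, that occurs in `HL_λ`.

The combinatorial inputs are the exchange condition (`exists_word_exchange`), the fact that
`u < u s_β` in the Bruhat order whenever `uβ` is positive (`bruhatLT_mul_refl_iff`), and the fact that a
path from `𝔄` to `𝔄 + λ` of minimal length crosses no hyperplane in both directions, since otherwise
the part between the two crossings could be reflected and the path shortened
(`exists_shorter_walk`). As `λ` is dominant, all roots `β_j` are then positive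
(`IsReducedChain.exists_floorPath`).
-/

noncomputable section

namespace HallLittlewood

variable {ι X Y : Type*} [AddCommGroup X] [AddCommGroup Y] {P : RootDatum ι X Y}

section

/-! ### The Weyl group acting on weights and on roots -/

variable (P) in
/-- The integer `⟨x, α_i^∨⟩`. -/
abbrev pair (x : X) (i : ι) : ℤ := P.toLinearMap x (P.coroot i)

lemma root_smul (w : P.weylGroup) (i : ι) : P.root (w • i) = w • P.root i :=
  (RootPairing.weylGroup_apply_root P w i).symm

lemma refl_smul (i : ι) (x : X) : refl P i • x = x - pair P x i • P.root i := by
  rw [refl, RootPairing.weylGroup.ofIdx_smul, RootPairing.Equiv.reflection_smul,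
    RootPairing.reflection_apply]
  rfl

lemma refl_smul_idx (i j : ι) : refl P i • j = P.reflectionPerm i j := rfl

lemma refl_smul_self (i : ι) : refl P i • i = negIdx P i := rfl

@[simp]
lemma root_negIdx (i : ι) : P.root (negIdx P i) = -P.root i := by
  simp [negIdx]

@[simp]
lemma coroot_negIdx (i : ι) : P.coroot (negIdx P i) = -P.coroot i := by
  simp [negIdx]

@[simp]
lemma negIdx_negIdx (i : ι) : negIdx P (negIdx P i) = i := by
  apply P.root.injective
  simp

lemma pair_negIdx (x : X) (i : ι) : pair P x (negIdx P i) = -pair P x i := by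
  simp [pair]

lemma pair_root_self (i : ι) : pair P (P.root i) i = 2 := by
  simp [pair]

lemma coroot_refl_smul (i j : ι) :
    P.coroot (refl P i • j) = P.coroot j - pair P (P.root i) j • P.coroot i := by
  rw [refl_smul_idx, RootPairing.coroot_reflectionPerm, RootPairing.coreflection_apply]

lemma pair_refl_smul (x : X) (i j : ι) :
    pair P x (refl P i • j) = pair P x j - pair P (P.root i) j * pair P x i := by
  rw [pair, coroot_refl_smul, map_sub, map_zsmul, smul_eq_mul]

lemma pair_smul (w : P.weylGroup) (x : X) (i : ι) : pair P (w • x) (w • i) = pair P x i := by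
  obtain ⟨g, hg⟩ := w
  have h2 := LinearMap.congr_fun
    (RootPairing.Hom.weight_coweight_transpose_apply P P (P.coroot (g • i)) g.toHom) x
  have h3 := RootPairing.Hom.coroot_coweightMap_apply P P (g • i) g.toHom
  have h4 : g.toHom.indexEquiv.symm (g • i) = i := g.toHom.indexEquiv.symm_apply_apply i
  rw [h4] at h3
  rw [h3] at h2
  exact h2

lemma pair_inv_smul (w : P.weylGroup) (x : X) (i : ι) :
    pair P x (w⁻¹ • i) = pair P (w • x) i := by
  rw [← pair_smul w, smul_inv_smul]

lemma smul_negIdx (w : P.weylGroup) (i : ι) : w • negIdx P i = negIdx P (w • i) := by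
  apply P.root.injective
  rw [root_smul, root_negIdx, root_negIdx, root_smul, smul_neg]

lemma weylGroup_ext {w w' : P.weylGroup} (h : ∀ x : X, w • x = w' • x) : w = w' :=
  Subtype.ext (RootPairing.Equiv.weightHom_injective P (LinearEquiv.ext h))

lemma smul_zsmul_weight (w : P.weylGroup) (n : ℤ) (x : X) : w • (n • x) = n • (w • x) :=
  map_zsmul (DistribSMul.toAddMonoidHom X w) n x

lemma refl_smul_smul (w : P.weylGroup) (i : ι) : refl P (w • i) = w * refl P i * w⁻¹ := by
  apply weylGroup_ext
  intro x
  rw [refl_smul, mul_smul, mul_smul, refl_smul, smul_sub, smul_inv_smul, smul_zsmul_weight,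
    ← root_smul, ← pair_smul w (w⁻¹ • x), smul_inv_smul]

lemma refl_mul_self (i : ι) : refl P i * refl P i = 1 := by
  apply weylGroup_ext
  intro x
  rw [mul_smul, one_smul]
  simp

lemma refl_mul_refl_mul (i : ι) (w : P.weylGroup) : refl P i * (refl P i * w) = w := by
  rw [← mul_assoc, refl_mul_self, one_mul]

lemma mul_refl_mul_refl (w : P.weylGroup) (i : ι) : w * refl P i * refl P i = w := by
  rw [mul_assoc, refl_mul_self, mul_one]

lemma refl_inv (i : ι) : (refl P i)⁻¹ = refl P i :=
  inv_eq_of_mul_eq_one_left (refl_mul_self i)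

lemma refl_smul_refl_smul (i j : ι) : refl P i • refl P i • j = j := by
  rw [← mul_smul, refl_mul_self, one_smul]

lemma refl_negIdx (i : ι) : refl P (negIdx P i) = refl P i := by
  rw [← refl_smul_self, refl_smul_smul, refl_inv, mul_refl_mul_refl]

lemma refl_mul_inv_smul (i : ι) (w : P.weylGroup) (j : ι) :
    (refl P i * w)⁻¹ • j = w⁻¹ • refl P i • j := by
  rw [mul_inv_rev, refl_inv, mul_smul]

lemma refl_mul_inv_smul_self (i : ι) (w : P.weylGroup) :
    (refl P i * w)⁻¹ • i = negIdx P (w⁻¹ • i) := by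
  rw [refl_mul_inv_smul, refl_smul_self, smul_negIdx]

lemma mul_refl_eq (w : P.weylGroup) (i : ι) : w * refl P i = refl P (w • i) * w := by
  rw [refl_smul_smul, inv_mul_cancel_right]

/-! ### Positive roots -/

variable (b : P.Base)

lemma isPos_negIdx (i : ι) : b.IsPos (negIdx P i) ↔ ¬ b.IsPos i :=
  RootPairing.Base.IsPos.neg_iff_not b i

lemma isPos_smul_refl_self {w : P.weylGroup} {i : ι} :
    b.IsPos ((w * refl P i) • i) ↔ ¬ b.IsPos (w • i) := by
  rw [mul_smul, refl_smul_self, smul_negIdx, isPos_negIdx]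

lemma ne_negIdx_of_isPos {i j : ι} (hi : b.IsPos i) (hj : b.IsPos j) : i ≠ negIdx P j := by
  rintro rfl
  exact (isPos_negIdx b j).1 hi hj

variable {b}

lemma isPos_refl_smul [Finite ι] [P.IsReduced] {i j : ι} (hi : i ∈ b.support) (hj : b.IsPos j)
    (hij : j ≠ i) : b.IsPos (refl P i • j) :=
  hj.reflectionPerm hi hij

lemma isPos_refl_smul_iff [Finite ι] [P.IsReduced] {i j : ι} (hi : i ∈ b.support)
    (h1 : j ≠ i) (h2 : j ≠ negIdx P i) : b.IsPos (refl P i • j) ↔ b.IsPos j := by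
  by_cases hj : b.IsPos j
  · simp [hj, isPos_refl_smul hi hj h1]
  · have h3 := isPos_refl_smul hi ((isPos_negIdx b j).2 hj) (fun h ↦ h2 (by rw [← h]; simp))
    rw [smul_negIdx, isPos_negIdx] at h3
    simp [hj, h3]

/-! ### Words in the simple reflections and the length function -/

variable [Finite ι] [P.IsReduced]

lemma exists_simple_word (b : P.Base) (w : P.weylGroup) :
    ∃ s : List ι, (∀ i ∈ s, i ∈ b.support) ∧ (s.map (refl P)).prod = w := by
  have key : ∀ i : ι, ∃ s : List ι, (∀ i ∈ s, i ∈ b.support) ∧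
      (s.map (refl P)).prod = refl P i := by
    intro i
    refine b.induction_reflect i (p := fun i ↦ ∃ s : List ι, (∀ i ∈ s, i ∈ b.support) ∧
      (s.map (refl P)).prod = refl P i) ?_ ?_ ?_
    · rintro i ⟨s, h1, h2⟩
      exact ⟨s, h1, by rw [h2]; exact (refl_negIdx i).symm⟩
    · intro i hi
      exact ⟨[i], by simpa using hi, by simp⟩
    · rintro i j ⟨s, h1, h2⟩ hj
      refine ⟨j :: (s ++ [j]), ?_, ?_⟩
      · intro k hk
        simp only [List.mem_cons, List.mem_append, List.not_mem_nil, or_false] at hk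
        rcases hk with rfl | hk | rfl
        exacts [hj, h1 _ hk, hj]
      · rw [← refl_smul_idx, refl_smul_smul, refl_inv]
        simp [h2, mul_assoc]
  obtain ⟨g, hg⟩ := w
  induction hg using RootPairing.weylGroup.induction with
  | mem i => exact key i
  | one => exact ⟨[], by simp, by simp; rfl⟩
  | mul x y hx hy h1 h2 =>
    obtain ⟨s, hs, hs'⟩ := h1
    obtain ⟨s', ht, ht'⟩ := h2
    refine ⟨s ++ s', ?_, ?_⟩
    · intro k hk
      rcases List.mem_append.1 hk with hk | hk
      exacts [hs k hk, ht k hk]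
    · rw [List.map_append, List.prod_append, hs', ht']
      rfl

lemma exists_reduced_word (b : P.Base) (w : P.weylGroup) :
    ∃ s : List ι, (∀ i ∈ s, i ∈ b.support) ∧ s.length = len b w ∧ (s.map (refl P)).prod = w := by
  obtain ⟨s, h1, h2⟩ := exists_simple_word b w
  exact Nat.sInf_mem (s := {n | ∃ s : List ι, (∀ i ∈ s, i ∈ b.support) ∧ s.length = n ∧
    (s.map (refl P)).prod = w}) ⟨_, s, h1, rfl, h2⟩

omit [Finite ι] [P.IsReduced] in
lemma len_prod_le (s : List ι) (hs : ∀ i ∈ s, i ∈ b.support) :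
    len b (s.map (refl P)).prod ≤ s.length :=
  Nat.sInf_le ⟨s, hs, rfl, rfl⟩

omit [Finite ι] [P.IsReduced] in
@[simp]
lemma len_one : len b (1 : P.weylGroup) = 0 :=
  Nat.le_zero.1 (len_prod_le [] (by simp))

lemma len_refl_mul_le {i : ι} (hi : i ∈ b.support) (w : P.weylGroup) :
    len b (refl P i * w) ≤ len b w + 1 := by
  obtain ⟨s, h1, h2, rfl⟩ := exists_reduced_word b w
  rw [← h2]
  exact len_prod_le (i :: s) (by simpa [hi] using h1)

lemma exists_refl_mul_of_ne_one {w : P.weylGroup} (hw : w ≠ 1) :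
    ∃ i ∈ b.support, len b (refl P i * w) < len b w := by
  obtain ⟨s, h1, h2, rfl⟩ := exists_reduced_word b w
  cases s with
  | nil => simp at hw
  | cons i s =>
    refine ⟨i, h1 i (by simp), ?_⟩
    rw [← h2, List.map_cons, List.prod_cons, refl_mul_refl_mul, List.length_cons]
    exact Nat.lt_succ_of_le (len_prod_le s fun j hj ↦ h1 j (by simp [hj]))

/-- The exchange condition: if `w⁻¹` makes the positive root `r` negative, then a word for `s_r w`
is obtained from a word for `w` by deleting a letter. -/
lemma exists_word_exchange (s : List ι) (hs : ∀ i ∈ s, i ∈ b.support) {r : ι} (hr : b.IsPos r)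
    (hneg : ¬ b.IsPos ((s.map (refl P)).prod⁻¹ • r)) :
    ∃ s' : List ι, (∀ i ∈ s', i ∈ b.support) ∧ s'.length + 1 = s.length ∧
      (s'.map (refl P)).prod = refl P r * (s.map (refl P)).prod := by
  induction s generalizing r with
  | nil => simp [hr] at hneg
  | cons j s ih =>
    have hj : j ∈ b.support := hs j (by simp)
    have hs' : ∀ i ∈ s, i ∈ b.support := fun i hi ↦ hs i (by simp [hi])
    rw [List.map_cons, List.prod_cons] at hneg ⊢
    by_cases hrj : r = j
    · subst hrj
      exact ⟨s, hs', rfl, by rw [refl_mul_refl_mul]⟩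
    · rw [refl_mul_inv_smul] at hneg
      obtain ⟨s', h1, h2, h3⟩ := ih hs' (isPos_refl_smul hj hr hrj) hneg
      refine ⟨j :: s', by simpa [hj] using h1, by simp [h2], ?_⟩
      rw [List.map_cons, List.prod_cons, h3, refl_smul_smul, refl_inv, ← mul_assoc, ← mul_assoc,
        ← mul_assoc, refl_mul_self, one_mul, mul_assoc]

lemma len_refl_mul_lt {r : ι} (hr : b.IsPos r) {w : P.weylGroup} (h : ¬ b.IsPos (w⁻¹ • r)) :
    len b (refl P r * w) < len b w := by
  obtain ⟨s, h1, h2, rfl⟩ := exists_reduced_word b w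
  obtain ⟨s', h3, h4, h5⟩ := exists_word_exchange s h1 hr h
  rw [← h5, ← h2, ← h4]
  exact Nat.lt_succ_of_le (len_prod_le s' h3)

lemma lt_len_refl_mul {r : ι} (hr : b.IsPos r) {w : P.weylGroup} (h : b.IsPos (w⁻¹ • r)) :
    len b w < len b (refl P r * w) := by
  have := len_refl_mul_lt hr (w := refl P r * w)
    (by rw [refl_mul_inv_smul_self, isPos_negIdx]; exact not_not.2 h)
  rwa [refl_mul_refl_mul] at this

lemma lt_len_mul_refl {r : ι} (hr : b.IsPos r) {w : P.weylGroup} (h : b.IsPos (w • r)) :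
    len b w < len b (w * refl P r) := by
  rw [mul_refl_eq]
  exact lt_len_refl_mul h (by rwa [inv_smul_smul])

lemma len_mul_refl_lt {r : ι} (hr : b.IsPos r) {w : P.weylGroup} (h : ¬ b.IsPos (w • r)) :
    len b (w * refl P r) < len b w := by
  have := lt_len_mul_refl hr (w := w * refl P r) ((isPos_smul_refl_self b).2 h)
  rwa [mul_refl_mul_refl] at this

lemma isPos_smul_of_len_lt {r : ι} (hr : b.IsPos r) {w : P.weylGroup}
    (h : len b w < len b (w * refl P r)) : b.IsPos (w • r) := by
  by_contra hn
  exact absurd (len_mul_refl_lt hr hn) (by omega)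

lemma len_refl_mul_of_isPos {i : ι} (hi : i ∈ b.support) {w : P.weylGroup}
    (h : b.IsPos (w⁻¹ • i)) : len b (refl P i * w) = len b w + 1 :=
  le_antisymm (len_refl_mul_le hi w) (lt_len_refl_mul (RootPairing.Base.isPos_of_mem_support hi) h)

lemma len_refl_mul_of_not_isPos {i : ι} (hi : i ∈ b.support) {w : P.weylGroup}
    (h : ¬ b.IsPos (w⁻¹ • i)) : len b (refl P i * w) + 1 = len b w := by
  have := len_refl_mul_of_isPos hi (w := refl P i * w)
    (by rw [refl_mul_inv_smul_self, isPos_negIdx]; exact h)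
  rw [refl_mul_refl_mul] at this
  exact this.symm

lemma isPos_inv_smul_of_len_lt {i : ι} (hi : i ∈ b.support) {w : P.weylGroup}
    (h : len b w < len b (refl P i * w)) : b.IsPos (w⁻¹ • i) := by
  by_contra hn
  have := len_refl_mul_of_not_isPos hi hn
  omega

/-- Simple left multiplications change the length by one, hence its parity. -/
lemma len_refl_mul_mod_two {i : ι} (hi : i ∈ b.support) (w : P.weylGroup) :
    len b (refl P i * w) % 2 = (len b w + 1) % 2 := by
  by_cases h : b.IsPos (w⁻¹ • i)
  · rw [len_refl_mul_of_isPos hi h]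
  · have := len_refl_mul_of_not_isPos hi h
    omega

lemma len_refl_mul_mod_two' (r : ι) : ∀ w : P.weylGroup,
    len b (refl P r * w) % 2 = (len b w + 1) % 2 := by
  refine b.induction_reflect r (p := fun r ↦ ∀ w : P.weylGroup,
    len b (refl P r * w) % 2 = (len b w + 1) % 2) ?_ ?_ ?_
  · intro i h w
    have := h w
    rwa [← refl_negIdx] at this
  · intro i hi w
    exact len_refl_mul_mod_two hi w
  · intro i j h hj w
    rw [← refl_smul_idx, refl_smul_smul, refl_inv, mul_assoc, mul_assoc]
    have h1 := len_refl_mul_mod_two hj (refl P i * (refl P j * w))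
    have h2 := h (refl P j * w)
    have h3 := len_refl_mul_mod_two hj w
    omega

lemma len_mul_refl_mod_two (r : ι) (w : P.weylGroup) :
    len b (w * refl P r) % 2 = (len b w + 1) % 2 := by
  rw [mul_refl_eq]
  exact len_refl_mul_mod_two' _ _

/-! ### Inversions -/

variable (b) in
/-- The positive roots that `w⁻¹` makes negative. -/
def inversions (w : P.weylGroup) : Finset ι :=
  (Set.toFinite {i | b.IsPos i ∧ ¬ b.IsPos (w⁻¹ • i)}).toFinset

omit [P.IsReduced] in
lemma mem_inversions {w : P.weylGroup} {i : ι} :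
    i ∈ inversions b w ↔ b.IsPos i ∧ ¬ b.IsPos (w⁻¹ • i) := by
  simp [inversions]

omit [P.IsReduced] in
lemma inversions_one : inversions b (1 : P.weylGroup) = ∅ := by
  ext i
  simp [mem_inversions]

/-- The inversions of `s_i w`, when `w < s_i w`: the images under `s_i` of those of `w`, and the
simple root `α_i`. -/
lemma inversions_refl_mul {i : ι} (hi : i ∈ b.support) {w : P.weylGroup} (h : b.IsPos (w⁻¹ • i)) :
    inversions b (refl P i * w) =
      Finset.cons i ((inversions b w).map (MulAction.toPerm (refl P i)).toEmbedding) (by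
        simp only [Finset.mem_map, Equiv.coe_toEmbedding, MulAction.toPerm_apply, not_exists,
          not_and, mem_inversions]
        rintro j ⟨hj, -⟩ hji
        rw [← refl_smul_refl_smul (P := P) i j, hji, refl_smul_self, isPos_negIdx] at hj
        exact hj (RootPairing.Base.isPos_of_mem_support hi)) := by
  have hi' := RootPairing.Base.isPos_of_mem_support hi
  ext j
  simp only [Finset.mem_cons, Finset.mem_map, Equiv.coe_toEmbedding, MulAction.toPerm_apply,
    mem_inversions, refl_mul_inv_smul]
  constructor
  · rintro ⟨h1, h2⟩
    by_cases hji : j = i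
    · exact Or.inl hji
    · exact Or.inr ⟨refl P i • j, ⟨isPos_refl_smul hi h1 hji, h2⟩, refl_smul_refl_smul i j⟩
  · rintro (rfl | ⟨k, ⟨h1, h2⟩, rfl⟩)
    · rw [refl_smul_self, smul_negIdx, isPos_negIdx]
      exact ⟨hi', not_not.2 h⟩
    · rw [refl_smul_refl_smul]
      refine ⟨isPos_refl_smul hi h1 ?_, h2⟩
      rintro rfl
      exact h2 h

/-- Induction on the Weyl group along increasing left multiplications by simple reflections. -/
lemma weyl_induction (b : P.Base) {p : P.weylGroup → Prop} (one : p 1)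
    (step : ∀ i ∈ b.support, ∀ w : P.weylGroup, b.IsPos (w⁻¹ • i) → p w → p (refl P i * w))
    (w : P.weylGroup) : p w := by
  induction hn : len b w using Nat.strong_induction_on generalizing w with
  | _ n ih =>
    by_cases hw : w = 1
    · rwa [hw]
    · obtain ⟨i, hi, hlt⟩ := exists_refl_mul_of_ne_one (b := b) hw
      have := step i hi (refl P i * w) (isPos_inv_smul_of_len_lt hi (by rwa [refl_mul_refl_mul]))
        (ih _ (hn ▸ hlt) _ rfl)
      rwa [refl_mul_refl_mul] at this

lemma len_eq_card_inversions (w : P.weylGroup) : len b w = (inversions b w).card := by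
  induction w using weyl_induction b with
  | one => simp [inversions_one]
  | step i hi w h ih =>
    rw [len_refl_mul_of_isPos hi h, inversions_refl_mul hi h, Finset.card_cons, Finset.card_map, ih]

/-! ### The chain property of the Bruhat order -/

lemma bruhatCovers_refl_mul {i : ι} (hi : i ∈ b.support) {w : P.weylGroup}
    (h : b.IsPos (w⁻¹ • i)) : BruhatCovers b w (refl P i * w) := by
  refine ⟨w⁻¹ • i, ?_, len_refl_mul_of_isPos hi h⟩
  rw [mul_refl_eq, smul_inv_smul]

omit [Finite ι] [P.IsReduced] in
lemma BruhatLT.len_lt {u v : P.weylGroup} (h : BruhatLT b u v) : len b u < len b v := by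
  induction h with
  | single h => obtain ⟨-, -, h⟩ := h; omega
  | tail _ h ih => obtain ⟨-, -, h⟩ := h; omega

variable (b) in
open Classical in
/-- The longer one of `w` and `s_i w`. -/
def raise (i : ι) (w : P.weylGroup) : P.weylGroup :=
  if b.IsPos (w⁻¹ • i) then refl P i * w else w

/-- Replacing elements by the longer ones in their cosets modulo `s_i` on the left preserves the
Bruhat order. -/
lemma BruhatCovers.raise {i : ι} (hi : i ∈ b.support) {u v : P.weylGroup}
    (h : BruhatCovers b u v) :
    Relation.ReflTransGen (BruhatCovers b) (raise b i u) (raise b i v) := by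
  unfold HallLittlewood.raise
  have huv := h
  obtain ⟨r, rfl, hlen⟩ := h
  split_ifs with hu hv hv
  · refine .single ⟨r, by rw [mul_assoc], ?_⟩
    rw [len_refl_mul_of_isPos hi hu, len_refl_mul_of_isPos hi hv, hlen]
  · -- here `s_i u = u s_r`, since otherwise `s_i u < s_i u s_r`, against the lengths
    wlog hr : b.IsPos r generalizing r
    · rw [← refl_negIdx r] at hlen hv huv ⊢
      exact this (negIdx P r) huv hlen hv ((isPos_negIdx b r).2 hr)
    have hur : b.IsPos (u • r) := isPos_smul_of_len_lt hr (by omega)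
    by_cases he : u • r = i
    · rw [mul_refl_eq, he]
    · have h1 : b.IsPos ((refl P i * u) • r) := by
        rw [mul_smul]
        exact isPos_refl_smul hi hur he
      have h2 := lt_len_mul_refl hr h1
      rw [mul_assoc] at h2
      have h3 := len_refl_mul_of_isPos hi hu
      have h4 := len_refl_mul_of_not_isPos hi hv
      omega
  · exact (Relation.ReflTransGen.single huv).tail (bruhatCovers_refl_mul hi hv)
  · exact .single huv

lemma bruhatLT_mul_refl {r : ι} (hr : b.IsPos r) {u : P.weylGroup} (h : b.IsPos (u • r)) :
    BruhatLT b u (u * refl P r) := by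
  induction hn : len b (u * refl P r) using Nat.strong_induction_on generalizing u with
  | _ n ih =>
    have hlt := lt_len_mul_refl hr h
    obtain ⟨i, hi, hi'⟩ := exists_refl_mul_of_ne_one (b := b) (w := u * refl P r) (by
      intro h1
      rw [h1, len_one] at hlt
      omega)
    have hv : ¬ b.IsPos ((u * refl P r)⁻¹ • i) := fun h' ↦ by
      have := lt_len_refl_mul (RootPairing.Base.isPos_of_mem_support hi) h'
      omega
    by_cases he : u • r = i
    · rw [mul_refl_eq, he]
      refine .single (bruhatCovers_refl_mul hi ?_)
      rwa [← he, inv_smul_smul]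
    have h1 : b.IsPos ((refl P i * u) • r) := by
      rw [mul_smul]
      exact isPos_refl_smul hi h he
    have h2 := ih (len b (refl P i * u * refl P r)) (by rw [mul_assoc]; omega) h1 rfl
    have h3 := len_refl_mul_of_not_isPos hi hv
    have hvr : raise b i (refl P i * u * refl P r) = u * refl P r := by
      rw [raise, mul_assoc, if_pos, refl_mul_refl_mul]
      rwa [refl_mul_inv_smul_self, isPos_negIdx]
    -- the chain from `s_i u` to `s_i u s_r` is lifted to one that ends at `u s_r`
    have h4 : Relation.ReflTransGen (BruhatCovers b) (raise b i (refl P i * u)) (u * refl P r) := by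
      rw [← hvr]
      exact Relation.ReflTransGen.lift' (raise b i) (fun _ _ h ↦ BruhatCovers.raise hi h)
        _ _ h2.to_reflTransGen
    by_cases hu : b.IsPos (u⁻¹ • i)
    · rw [raise, if_neg] at h4
      · exact Relation.TransGen.head' (bruhatCovers_refl_mul hi hu) h4
      · rwa [refl_mul_inv_smul_self, isPos_negIdx, not_not]
    · rw [raise, if_pos, refl_mul_refl_mul] at h4
      · rcases Relation.reflTransGen_iff_eq_or_transGen.1 h4 with h5 | h5
        · rw [h5] at hlt
          omega
        · exact h5
      · rwa [refl_mul_inv_smul_self, isPos_negIdx]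

lemma bruhatLT_mul_refl_iff {r : ι} (hr : b.IsPos r) {u : P.weylGroup} :
    BruhatLT b u (u * refl P r) ↔ b.IsPos (u • r) :=
  ⟨fun h ↦ isPos_smul_of_len_lt hr h.len_lt, bruhatLT_mul_refl hr⟩

end

section

variable {b : P.Base}

/-! ### Dominant weights -/

/-- The invariant form turns `⟨x, α_i^∨⟩` into a function of `α_i` that is additive up to positive
scalars. -/
lemma exists_linear_pair [Finite ι] (P : RootDatum ι X Y) (x : X) :
    ∃ (N : ι → ℤ) (φ : X →ₗ[ℤ] ℤ), ∀ i, 0 < N i ∧ φ (P.root i) = N i * pair P x i := by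
  have := Fintype.ofFinite ι
  refine ⟨fun i ↦ P.RootForm (P.root i) (P.root i),
    (2 : ℤ) • (P.toLinearMap x).comp P.Polarization, fun i ↦ ⟨?_, ?_⟩⟩
  · beta_reduce
    rw [RootPairing.rootForm_apply_apply]
    refine Finset.sum_pos' (fun j _ ↦ mul_self_nonneg _) ⟨i, Finset.mem_univ i, ?_⟩
    simp [RootPairing.coroot']
  · have h := congrArg (P.toLinearMap x) (P.rootForm_self_smul_coroot i)
    rw [map_smul, map_nsmul] at h
    simpa using h.symm

lemma exists_root_eq_nat_sum {i : ι} (hi : b.IsPos i) :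
    ∃ f : ι → ℕ, P.root i = ∑ j ∈ b.support, f j • P.root j := by
  obtain ⟨f, -, h | h⟩ := b.exists_root_eq_sum_nat_or_neg i
  · exact ⟨f, h⟩
  · have h1 : P.root i = ∑ j ∈ b.support, (fun j ↦ -(f j : ℤ)) j • P.root j := by
      simpa [neg_smul] using h
    have h2 := RootPairing.Base.height_eq_sum h1
    rw [RootPairing.Base.isPos_iff, h2] at hi
    exact absurd hi (not_lt.2 (Finset.sum_nonpos (by simp)))

lemma pair_nonneg [Finite ι] {lam : X} (hlam : ∀ i ∈ b.support, 0 ≤ pair P lam i) {i : ι}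
    (hi : b.IsPos i) : 0 ≤ pair P lam i := by
  obtain ⟨N, φ, h⟩ := exists_linear_pair P lam
  obtain ⟨f, hf⟩ := exists_root_eq_nat_sum hi
  have h1 := (h i).2
  rw [hf, map_sum] at h1
  have h2 : 0 ≤ N i * pair P lam i := by
    rw [← h1]
    refine Finset.sum_nonneg fun j hj ↦ ?_
    rw [map_nsmul, (h j).2]
    exact nsmul_nonneg (mul_nonneg (h j).1.le (hlam j hj)) _
  exact nonneg_of_mul_nonneg_right h2 (h i).1

lemma mem_outerRoots_iff [Finite ι] {lam : X} (hlam : ∀ i ∈ b.support, 0 ≤ pair P lam i) {i : ι} :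
    i ∈ outerRoots b lam ↔ b.IsPos i ∧ 0 < pair P lam i := by
  obtain ⟨N, φ, h⟩ := exists_linear_pair P lam
  refine and_congr_right fun hi ↦ ⟨fun hs ↦ ?_, fun hpos hs ↦ ?_⟩
  · refine lt_of_le_of_ne (pair_nonneg hlam hi) fun h0 ↦ hs ?_
    obtain ⟨f, hf⟩ := exists_root_eq_nat_sum hi
    have h1 := (h i).2
    rw [← h0, mul_zero, hf, map_sum, Finset.sum_eq_zero_iff_of_nonneg] at h1
    · rw [hf]
      refine Submodule.sum_mem _ fun j hj ↦ ?_
      have h2 := h1 j hj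
      rw [map_nsmul, (h j).2, smul_eq_zero, mul_eq_zero, or_iff_right (h j).1.ne'] at h2
      rcases h2 with h2 | h2
      · simp [h2]
      · have h3 : P.root j ∈ Submodule.span ℤ (P.root '' simpleStab b lam) :=
          Submodule.subset_span ⟨j, ⟨hj, h2⟩, rfl⟩
        exact nsmul_mem h3 _
    · intro j hj
      rw [map_nsmul, (h j).2]
      exact nsmul_nonneg (mul_nonneg (h j).1.le (hlam j hj)) _
  · have h1 : Submodule.span ℤ (P.root '' simpleStab b lam) ≤ LinearMap.ker φ := by
      rw [Submodule.span_le]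
      rintro - ⟨j, hj, rfl⟩
      rw [SetLike.mem_coe, LinearMap.mem_ker, (h j).2, pair, hj.2, mul_zero]
    have h2 := h1 hs
    rw [LinearMap.mem_ker, (h i).2] at h2
    exact (mul_pos (h i).1 hpos).ne' h2

/-! ### Alcoves and their floor functions -/

variable (P) in
/-- `A` is the alcove of all points `x` such that `⟨x, α_i^∨⟩` has integral part `k i`, and no
`⟨x, α_i^∨⟩` is an integer. -/
def IsFloor (A : Set (Y →+ ℝ)) (k : ι → ℤ) : Prop :=
  A.Nonempty ∧ A = {x : Y →+ ℝ | ∀ i, (k i : ℝ) < x (P.coroot i) ∧ x (P.coroot i) < k i + 1}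

lemma IsAlcove.exists_isFloor {A : Set (Y →+ ℝ)} (h : IsAlcove P A) : ∃ k, IsFloor P A k := by
  obtain ⟨h1, k, h2⟩ := h
  exact ⟨k, h1, h2⟩

lemma IsFloor.isAlcove {A : Set (Y →+ ℝ)} {k : ι → ℤ} (h : IsFloor P A k) : IsAlcove P A :=
  ⟨h.1, k, h.2⟩

lemma IsFloor.lt {A : Set (Y →+ ℝ)} {k : ι → ℤ} (h : IsFloor P A k) {x : Y →+ ℝ} (hx : x ∈ A)
    (i : ι) : (k i : ℝ) < x (P.coroot i) ∧ x (P.coroot i) < k i + 1 := by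
  rw [h.2] at hx
  exact hx i

lemma IsFloor.unique {A : Set (Y →+ ℝ)} {k k' : ι → ℤ} (h : IsFloor P A k) (h' : IsFloor P A k') :
    k = k' := by
  obtain ⟨x, hx⟩ := h.1
  funext i
  have h1 := h.lt hx i
  have h2 := h'.lt hx i
  have h3 : k i < k' i + 1 := by exact_mod_cast h1.1.trans h2.2
  have h4 : k' i < k i + 1 := by exact_mod_cast h2.1.trans h1.2
  omega

lemma IsFloor.eq_of_eq {A B : Set (Y →+ ℝ)} {k : ι → ℤ} (h : IsFloor P A k) (h' : IsFloor P B k) :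
    A = B := h.2.trans h'.2.symm

lemma IsFloor.negIdx {A : Set (Y →+ ℝ)} {k : ι → ℤ} (h : IsFloor P A k) (i : ι) :
    k (negIdx P i) = -1 - k i := by
  obtain ⟨x, hx⟩ := h.1
  have h1 := h.lt hx i
  have h2 := h.lt hx (HallLittlewood.negIdx P i)
  rw [coroot_negIdx, map_neg] at h2
  have h3 : (k i : ℝ) + k (HallLittlewood.negIdx P i) < 0 := by linarith
  have h4 : (0 : ℝ) < k i + k (HallLittlewood.negIdx P i) + 2 := by linarith
  have h3' : k i + k (HallLittlewood.negIdx P i) < 0 := by exact_mod_cast h3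
  have h4' : 0 < k i + k (HallLittlewood.negIdx P i) + 2 := by exact_mod_cast h4
  omega

@[simp]
lemma weightPoint_apply (μ : X) (y : Y) : weightPoint P μ y = (P.toLinearMap μ y : ℝ) := rfl

lemma IsFloor.translate {A : Set (Y →+ ℝ)} {k : ι → ℤ} (h : IsFloor P A k) (μ : X) :
    IsFloor P (translate P A μ) (fun i ↦ k i + pair P μ i) := by
  refine ⟨h.1.image _, ?_⟩
  ext x
  constructor
  · rintro ⟨x, hx, rfl⟩ i
    have := h.lt hx i
    simp only [AddMonoidHom.add_apply, weightPoint_apply]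
    push_cast
    constructor <;> linarith
  · intro hx
    refine ⟨x - weightPoint P μ, ?_, sub_add_cancel _ _⟩
    rw [h.2]
    intro i
    have := hx i
    simp only [AddMonoidHom.sub_apply, weightPoint_apply]
    push_cast at this
    constructor <;> linarith

variable (P) in
/-- The reflection of `𝔱*_ℝ` in the hyperplane `H_{α,d}`. -/
def reflPoint (i : ι) (d : ℤ) (x : Y →+ ℝ) : Y →+ ℝ :=
  x - (x (P.coroot i) - d) • weightPoint P (P.root i)

variable (P) in
/-- The effect of the reflection in `H_{α,d}` on the floor functions of alcoves. -/
def reflFloor (i : ι) (d : ℤ) (k : ι → ℤ) : ι → ℤ :=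
  fun j ↦ k (refl P i • j) + d * pair P (P.root i) j

lemma reflPoint_coroot (i : ι) (d : ℤ) (x : Y →+ ℝ) (j : ι) :
    reflPoint P i d x (P.coroot j) =
      x (P.coroot (refl P i • j)) + ((d * pair P (P.root i) j : ℤ) : ℝ) := by
  rw [coroot_refl_smul, map_sub, map_zsmul]
  simp only [reflPoint, AddMonoidHom.sub_apply, AddMonoidHom.smul_apply, weightPoint_apply,
    smul_eq_mul, zsmul_eq_mul]
  push_cast
  ring

lemma reflPoint_reflPoint (i : ι) (d : ℤ) (x : Y →+ ℝ) :
    reflPoint P i d (reflPoint P i d x) = x := by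
  have h : reflPoint P i d x (P.coroot i) = -x (P.coroot i) + 2 * d := by
    rw [reflPoint_coroot, refl_smul_self, coroot_negIdx, map_neg, pair_root_self]
    push_cast
    ring
  rw [reflPoint, h, reflPoint]
  module

lemma IsFloor.image_reflPoint {A : Set (Y →+ ℝ)} {k : ι → ℤ} (h : IsFloor P A k) (i : ι) (d : ℤ) :
    IsFloor P (reflPoint P i d '' A) (reflFloor P i d k) := by
  refine ⟨h.1.image _, ?_⟩
  have key : ∀ x ∈ A, ∀ j, ((reflFloor P i d k j : ℤ) : ℝ) < reflPoint P i d x (P.coroot j) ∧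
      reflPoint P i d x (P.coroot j) < (reflFloor P i d k j : ℤ) + 1 := by
    intro x hx j
    have := h.lt hx (refl P i • j)
    rw [reflPoint_coroot, reflFloor]
    push_cast
    constructor <;> linarith
  ext x
  constructor
  · rintro ⟨x, hx, rfl⟩
    exact key x hx
  · intro hx
    refine ⟨reflPoint P i d x, ?_, reflPoint_reflPoint i d x⟩
    rw [h.2]
    intro j
    have := hx (refl P i • j)
    rw [reflFloor, refl_smul_refl_smul, pair_refl_smul, pair_root_self] at this
    rw [reflPoint_coroot]
    push_cast at this ⊢
    constructor <;> linarith

/-! ### Crossing a wall -/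

lemma hyperplane_eq_iff [Finite ι] [Module.Free ℤ X] [P.IsReduced] {i j : ι} {m d : ℤ} :
    hyperplane P j m = hyperplane P i d ↔
      (j = i ∧ m = d) ∨ (j = negIdx P i ∧ m = -d) := by
  constructor
  · intro h
    -- a point of `H_{α_i,d}`
    set x₀ : Y →+ ℝ := ((d : ℝ) / 2) • weightPoint P (P.root i) with hx₀
    have hx₀i : x₀ (P.coroot i) = d := by
      have : P.toLinearMap (P.root i) (P.coroot i) = 2 := pair_root_self i
      simp only [hx₀, AddMonoidHom.smul_apply, weightPoint_apply, this, smul_eq_mul]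
      push_cast
      ring
    have h0 : x₀ (P.coroot j) = m := by
      have : x₀ ∈ hyperplane P i d := hx₀i
      rw [← h] at this
      exact this
    -- a direction parallel to `H_{α_i,d}`
    set z : X := (2 : ℤ) • P.root j - pair P (P.root j) i • P.root i with hz
    have hzi : pair P z i = 0 := by
      have h2 : P.toLinearMap (P.root i) (P.coroot i) = 2 := pair_root_self i
      rw [pair, hz, map_sub, map_zsmul, map_zsmul, LinearMap.sub_apply, LinearMap.smul_apply,
        LinearMap.smul_apply, h2, smul_eq_mul, smul_eq_mul]
      ring
    have hzj : pair P z j = 0 := by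
      have h1 : x₀ + weightPoint P z ∈ hyperplane P i d := by
        change (x₀ + weightPoint P z) (P.coroot i) = d
        have hzi' : P.toLinearMap z (P.coroot i) = 0 := hzi
        rw [AddMonoidHom.add_apply, hx₀i, weightPoint_apply, hzi']
        simp
      rw [← h] at h1
      have h2 : (x₀ + weightPoint P z) (P.coroot j) = m := h1
      rw [AddMonoidHom.add_apply, h0, weightPoint_apply] at h2
      have h3 : ((pair P z j : ℤ) : ℝ) = 0 := by linarith
      exact_mod_cast h3
    have hw : P.coxeterWeightIn ℤ i j = 4 := by
      have h2 : P.toLinearMap (P.root j) (P.coroot j) = 2 := pair_root_self j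
      rw [pair, hz, map_sub, map_zsmul, map_zsmul, LinearMap.sub_apply, LinearMap.smul_apply,
        LinearMap.smul_apply, h2, smul_eq_mul, smul_eq_mul] at hzj
      have h4 : P.coxeterWeight i j = 4 := by
        simp only [RootPairing.coxeterWeight, ← RootPairing.root_coroot_eq_pairing]
        rw [pair] at hzj
        linarith
      have := P.algebraMap_coxeterWeightIn ℤ i j
      rw [h4] at this
      exact_mod_cast this
    by_cases hij : i = j
    · subst hij
      left
      rw [hx₀i] at h0
      exact ⟨rfl, by exact_mod_cast h0.symm⟩
    · right
      have h5 : P.root i = -P.root j := by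
        by_contra hne
        exact RootPairing.coxeterWeightIn_ne_four P ℤ hij hne hw
      have h6 : j = negIdx P i := by
        apply P.root.injective
        rw [root_negIdx, h5, neg_neg]
      refine ⟨h6, ?_⟩
      rw [h6, coroot_negIdx, map_neg, hx₀i] at h0
      exact_mod_cast h0.symm
  · rintro (⟨rfl, rfl⟩ | ⟨rfl, rfl⟩)
    · rfl
    · ext x
      change x (P.coroot (negIdx P i)) = _ ↔ x (P.coroot i) = _
      rw [coroot_negIdx, map_neg]
      push_cast
      rw [neg_inj]

/-- The floor functions on the two sides of a wall. -/
structure FloorStep (P : RootDatum ι X Y) (i : ι) (d : ℤ) (k k' : ι → ℤ) : Prop where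
  left : k i = d - 1
  right : k' i = d
  other : ∀ j, j ≠ i → j ≠ negIdx P i → k j = k' j

lemma FloorStep.crosses [Finite ι] [Module.Free ℤ X] [P.IsReduced] {A B : Set (Y →+ ℝ)}
    {k k' : ι → ℤ} (hA : IsFloor P A k) (hB : IsFloor P B k') {i : ι} {d : ℤ}
    (h : FloorStep P i d k k') : Crosses P i d A B := by
  have hA' : ∀ x ∈ A, (d : ℝ) - 1 < x (P.coroot i) ∧ x (P.coroot i) < d := by
    intro x hx
    have := hA.lt hx i
    rw [h.left] at this
    push_cast at this
    constructor <;> linarith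
  have hB' : ∀ x ∈ B, (d : ℝ) < x (P.coroot i) ∧ x (P.coroot i) < d + 1 := by
    intro x hx
    have := hB.lt hx i
    rwa [h.right] at this
  obtain ⟨x, hx⟩ := hA.1
  obtain ⟨y, hy⟩ := hB.1
  refine ⟨hA.isAlcove, hB.isAlcove, ⟨fun x hx ↦ (hA' x hx).2, fun x hx ↦ (hB' x hx).1⟩, ?_⟩
  intro j m hs
  rw [hyperplane_eq_iff]
  have hAx := hA' x hx
  have hBy := hB' y hy
  by_cases h1 : j = i
  · subst h1
    left
    refine ⟨rfl, ?_⟩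
    rcases hs with ⟨h2, h3⟩ | ⟨h2, h3⟩
    · have h2 := h2 x hx
      have h3 := h3 y hy
      have h4 : d - 1 < m := by exact_mod_cast hAx.1.trans h2
      have h5 : m < d + 1 := by exact_mod_cast h3.trans hBy.2
      omega
    · have h2 := h2 y hy
      have h3 := h3 x hx
      linarith
  by_cases h2 : j = negIdx P i
  · subst h2
    right
    refine ⟨rfl, ?_⟩
    rcases hs with ⟨h2, h3⟩ | ⟨h2, h3⟩
    · have h2 := h2 x hx
      have h3 := h3 y hy
      rw [coroot_negIdx, map_neg] at h2 h3
      linarith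
    · have h2 := h2 y hy
      have h3 := h3 x hx
      rw [coroot_negIdx, map_neg] at h2 h3
      have h4 : (d : ℝ) - 1 < -m := by linarith
      have h5 : (-m : ℝ) < d + 1 := by linarith
      have h4' : d - 1 < -m := by exact_mod_cast h4
      have h5' : -m < d + 1 := by exact_mod_cast h5
      omega
  · exfalso
    have h3 := hA.lt hx j
    have h4 := hB.lt hy j
    rw [← h.other j h1 h2] at h4
    rcases hs with ⟨h5, h6⟩ | ⟨h5, h6⟩
    · have h5 := h3.1.trans (h5 x hx)
      have h6 := (h6 y hy).trans h4.2
      have h5' : k j < m := by exact_mod_cast h5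
      have h6' : m < k j + 1 := by exact_mod_cast h6
      omega
    · have h5 := h4.1.trans (h5 y hy)
      have h6 := (h6 x hx).trans h3.2
      have h5' : k j < m := by exact_mod_cast h5
      have h6' : m < k j + 1 := by exact_mod_cast h6
      omega

lemma Crosses.floorStep [Finite ι] [Module.Free ℤ X] [P.IsReduced] {A B : Set (Y →+ ℝ)}
    {k k' : ι → ℤ} (hA : IsFloor P A k) (hB : IsFloor P B k') {i : ι} {d : ℤ}
    (h : Crosses P i d A B) : FloorStep P i d k k' := by
  obtain ⟨-, -, ⟨h1, h2⟩, h3⟩ := h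
  obtain ⟨x, hx⟩ := hA.1
  obtain ⟨y, hy⟩ := hB.1
  -- a hyperplane between the two floors separates the alcoves
  have sep : ∀ (j : ι) (m : ℤ), k j < m → m ≤ k' j → PointsAcross P j m A B := by
    intro j m hm hm'
    constructor
    · intro z hz
      have h4 := (hA.lt hz j).2
      have h5 : (k j : ℝ) + 1 ≤ m := by exact_mod_cast hm
      linarith
    · intro z hz
      have h4 := (hB.lt hz j).1
      have h5 : (m : ℝ) ≤ k' j := by exact_mod_cast hm'
      linarith
  have sep' : ∀ (j : ι) (m : ℤ), k' j < m → m ≤ k j → PointsAcross P j m B A := by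
    intro j m hm hm'
    constructor
    · intro z hz
      have h4 := (hB.lt hz j).2
      have h5 : (k' j : ℝ) + 1 ≤ m := by exact_mod_cast hm
      linarith
    · intro z hz
      have h4 := (hA.lt hz j).1
      have h5 : (m : ℝ) ≤ k j := by exact_mod_cast hm'
      linarith
  have hkd : k i < d := by exact_mod_cast (hA.lt hx i).1.trans (h1 x hx)
  have hdk : d < k' i + 1 := by exact_mod_cast (h2 y hy).trans (hB.lt hy i).2
  have only : ∀ m : ℤ, k i < m → m ≤ k' i → m = d := by
    intro m hm hm'
    have h4 := h3 i m (Or.inl (sep i m hm hm'))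
    rw [hyperplane_eq_iff] at h4
    rcases h4 with ⟨-, h4⟩ | ⟨h4, -⟩
    · exact h4
    · have := congrArg (pair P (P.root i)) h4
      rw [pair_negIdx, pair_root_self] at this
      omega
  refine ⟨?_, ?_, ?_⟩
  · by_contra hne
    have := only (d - 1) (by omega) (by omega)
    omega
  · by_contra hne
    have := only (d + 1) (by omega) (by omega)
    omega
  · intro j hj hj'
    by_contra hne
    have : ∃ m, Separates P j m A B := by
      rcases lt_or_gt_of_ne hne with hlt | hlt
      · exact ⟨k' j, Or.inl (sep j _ hlt le_rfl)⟩
      · exact ⟨k j, Or.inr (sep' j _ hlt le_rfl)⟩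
    obtain ⟨m, hm⟩ := this
    have h4 := h3 j m hm
    rw [hyperplane_eq_iff] at h4
    tauto

lemma FloorStep.symm {k k' : ι → ℤ} {i : ι} {d : ℤ} (h : FloorStep P i d k k')
    (hk : k (negIdx P i) = -1 - k i) (hk' : k' (negIdx P i) = -1 - k' i) :
    FloorStep P (negIdx P i) (-d) k' k := by
  refine ⟨?_, ?_, ?_⟩
  · rw [hk', h.right]
    ring
  · rw [hk, h.left]
    ring
  · intro j h1 h2
    rw [negIdx_negIdx] at h2
    exact (h.other j h2 h1).symm

/-- The two alcoves at a wall are exchanged by the reflection in the wall: their floor functions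
can be compared at a point of the wall. -/
lemma FloorStep.eq_reflFloor [Finite ι] [Module.Free ℤ X] [P.IsReduced] {A B : Set (Y →+ ℝ)}
    {k k' : ι → ℤ} (hA : IsFloor P A k) (hB : IsFloor P B k') {i : ι} {d : ℤ}
    (h : FloorStep P i d k k') : k' = reflFloor P i d k := by
  obtain ⟨x, hx⟩ := hA.1
  obtain ⟨y, hy⟩ := hB.1
  have hxi : x (P.coroot i) < d := by
    have := (hA.lt hx i).2
    rw [h.left] at this
    push_cast at this
    linarith
  have hyi : (d : ℝ) < y (P.coroot i) := by
    have := (hB.lt hy i).1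
    rwa [h.right] at this
  -- the point of the segment from `x` to `y` that lies on the wall
  set s : ℝ := (d - x (P.coroot i)) / (y (P.coroot i) - x (P.coroot i)) with hs
  have hden : 0 < y (P.coroot i) - x (P.coroot i) := by linarith
  have hs0 : 0 < s := div_pos (by linarith) hden
  have hs1 : s < 1 := by
    rw [hs, div_lt_one hden]
    linarith
  set p : Y →+ ℝ := (1 - s) • x + s • y with hp
  have hp_apply : ∀ z, p z = (1 - s) * x z + s * y z := fun z ↦ rfl
  have hpi : p (P.coroot i) = d := by
    rw [hp_apply, hs]
    field_simp
    ring
  have hpj : ∀ j, j ≠ i → j ≠ negIdx P i →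
      (k j : ℝ) < p (P.coroot j) ∧ p (P.coroot j) < k j + 1 := by
    intro j h1 h2
    have h3 := hA.lt hx j
    have h4 := hB.lt hy j
    rw [← h.other j h1 h2] at h4
    rw [hp_apply]
    constructor <;> nlinarith
  have hrp : reflPoint P i d p = p := by
    rw [reflPoint, hpi, sub_self, zero_smul, sub_zero]
  have hkn := hA.negIdx i
  have hkn' := hB.negIdx i
  funext j
  by_cases h1 : j = i
  · subst h1
    rw [reflFloor, refl_smul_self, pair_root_self, hkn, h.left, h.right]
    ring
  by_cases h2 : j = negIdx P i
  · subst h2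
    rw [reflFloor, smul_negIdx, refl_smul_self, negIdx_negIdx, pair_negIdx, pair_root_self, hkn',
      h.left, h.right]
    ring
  · have h3 := hpj j h1 h2
    have h4 := hpj (refl P i • j)
      (fun h' ↦ h2 (by rw [← refl_smul_refl_smul (P := P) i j, h', refl_smul_self]))
      (fun h' ↦ h1 (MulAction.injective (refl P i) (h'.trans (refl_smul_self i).symm)))
    rw [← h.other j h1 h2, reflFloor]
    have h5 := reflPoint_coroot (P := P) i d p j
    rw [hrp] at h5
    have h6 : (k j : ℝ) < ((k (refl P i • j) + d * pair P (P.root i) j : ℤ) : ℝ) + 1 := by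
      push_cast at h5 ⊢
      linarith
    have h7 : ((k (refl P i • j) + d * pair P (P.root i) j : ℤ) : ℝ) < k j + 1 := by
      push_cast at h5 ⊢
      linarith
    have h6' : k j < k (refl P i • j) + d * pair P (P.root i) j + 1 := by exact_mod_cast h6
    have h7' : k (refl P i • j) + d * pair P (P.root i) j < k j + 1 := by exact_mod_cast h7
    omega

lemma FloorStep.reflFloor {k k' : ι → ℤ} {i : ι} {d : ℤ} (h : FloorStep P i d k k') (r : ι)
    (e : ℤ) : FloorStep P (refl P r • i) (d + e * pair P (P.root r) (refl P r • i))
      (reflFloor P r e k) (reflFloor P r e k') := by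
  refine ⟨?_, ?_, ?_⟩
  · rw [HallLittlewood.reflFloor, refl_smul_refl_smul, h.left]
    ring
  · rw [HallLittlewood.reflFloor, refl_smul_refl_smul, h.right]
  · intro j h1 h2
    rw [HallLittlewood.reflFloor, HallLittlewood.reflFloor, h.other]
    · intro h'
      exact h1 (by rw [← h', refl_smul_refl_smul])
    · intro h'
      exact h2 (by rw [← smul_negIdx, ← h', refl_smul_refl_smul])

lemma Crosses.image_reflPoint [Finite ι] [Module.Free ℤ X] [P.IsReduced] {A B : Set (Y →+ ℝ)}
    {i : ι} {d : ℤ} (h : Crosses P i d A B) (r : ι) (e : ℤ) :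
    ∃ i' d', Crosses P i' d' (reflPoint P r e '' A) (reflPoint P r e '' B) := by
  obtain ⟨k, hA⟩ := h.1.exists_isFloor
  obtain ⟨k', hB⟩ := h.2.1.exists_isFloor
  exact ⟨_, _, ((h.floorStep hA hB).reflFloor r e).crosses (hA.image_reflPoint r e)
    (hB.image_reflPoint r e)⟩

lemma Crosses.image_reflPoint_eq [Finite ι] [Module.Free ℤ X] [P.IsReduced] {A B : Set (Y →+ ℝ)}
    {i : ι} {d : ℤ} (h : Crosses P i d A B) : reflPoint P i d '' A = B := by
  obtain ⟨k, hA⟩ := h.1.exists_isFloor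
  obtain ⟨k', hB⟩ := h.2.1.exists_isFloor
  have h1 := (h.floorStep hA hB).eq_reflFloor hA hB
  exact (h1 ▸ hA.image_reflPoint i d).eq_of_eq hB

lemma reflPoint_negIdx (i : ι) (d : ℤ) : reflPoint P (negIdx P i) (-d) = reflPoint P i d := by
  funext x
  ext y
  simp only [reflPoint, AddMonoidHom.sub_apply, AddMonoidHom.smul_apply, weightPoint_apply,
    coroot_negIdx, root_negIdx, map_neg, smul_eq_mul, LinearMap.neg_apply]
  push_cast
  ring

end

section

variable {b : P.Base}

/-! ### The fundamental alcove -/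

/-- There is a regular dominant weight, namely the sum of the positive roots. -/
lemma exists_pair_pos [Finite ι] [P.IsReduced] [Module.Free ℤ X] (b : P.Base) :
    ∃ x : X, ∀ i, b.IsPos i → 0 < pair P x i := by
  classical
  have := Fintype.ofFinite ι
  set R : Finset ι := Finset.univ.filter b.IsPos with hR
  have h2 : ∀ i ∈ b.support, pair P (∑ j ∈ R, P.root j) i = 2 := by
    intro i hi
    have hiR : i ∈ R := by simpa [hR] using RootPairing.Base.isPos_of_mem_support hi
    have hT : refl P i • ∑ j ∈ R.erase i, P.root j = ∑ j ∈ R.erase i, P.root j := by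
      rw [Finset.smul_sum]
      have hmem : ∀ j ∈ R.erase i, refl P i • j ∈ R.erase i := by
        intro j hj
        simp only [hR, Finset.mem_erase, Finset.mem_filter, Finset.mem_univ, true_and] at hj ⊢
        refine ⟨fun h ↦ ne_negIdx_of_isPos b hj.2 (RootPairing.Base.isPos_of_mem_support hi) ?_,
          isPos_refl_smul hi hj.2 hj.1⟩
        rw [← refl_smul_refl_smul (P := P) i j, h, refl_smul_self]
      refine Finset.sum_nbij' (fun j ↦ refl P i • j) (fun j ↦ refl P i • j) hmem hmem
        (fun j _ ↦ refl_smul_refl_smul i j) (fun j _ ↦ refl_smul_refl_smul i j) fun j _ ↦ ?_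
      rw [root_smul]
    have hT0 : pair P (∑ j ∈ R.erase i, P.root j) i = 0 := by
      rw [refl_smul, sub_eq_self, smul_eq_zero] at hT
      exact hT.resolve_right (P.ne_zero i)
    rw [← Finset.add_sum_erase R P.root hiR, pair, map_add, LinearMap.add_apply]
    change pair P _ i + pair P _ i = 2
    rw [hT0, pair_root_self, add_zero]
  refine ⟨∑ j ∈ R, P.root j, fun i hi ↦ ?_⟩
  have h3 : ∀ i ∈ b.support, 0 ≤ pair P (∑ j ∈ R, P.root j) i := fun i hi ↦ by simp [h2 i hi]
  refine ((mem_outerRoots_iff h3).1 ⟨hi, ?_⟩).2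
  have h4 : simpleStab b (∑ j ∈ R, P.root j) = ∅ := by
    ext j
    simp only [simpleStab, Set.mem_ofPred_eq, Set.mem_empty_iff_false, iff_false, not_and]
    intro hj h0
    have := h2 j hj
    rw [pair, h0] at this
    omega
  rw [h4]
  simpa using P.ne_zero i

variable (b) in
open Classical in
/-- The floor function of the fundamental alcove. -/
def fundFloor (i : ι) : ℤ := if b.IsPos i then 0 else -1

lemma isFloor_fundamentalAlcove [Finite ι] [P.IsReduced] [Module.Free ℤ X] (b : P.Base) :
    IsFloor P (fundamentalAlcove b) (fundFloor b) := by
  classical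
  have := Fintype.ofFinite ι
  constructor
  · obtain ⟨ρ, hρ⟩ := exists_pair_pos b
    set N : ℤ := 1 + ∑ j, |pair P ρ j| with hN
    have hlt : ∀ i, pair P ρ i < N := by
      intro i
      have h1 : |pair P ρ i| ≤ ∑ j, |pair P ρ j| :=
        Finset.single_le_sum (f := fun j ↦ |pair P ρ j|) (fun j _ ↦ abs_nonneg _)
          (Finset.mem_univ i)
      have := le_abs_self (pair P ρ i)
      omega
    have hN0 : (0 : ℝ) < N := by
      have : 0 ≤ ∑ j, |pair P ρ j| := Finset.sum_nonneg fun j _ ↦ abs_nonneg _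
      exact_mod_cast (by omega : 0 < N)
    refine ⟨(1 / N : ℝ) • weightPoint P ρ, fun i hi ↦ ?_⟩
    have h1 : (0 : ℝ) < (pair P ρ i : ℤ) := by exact_mod_cast hρ i hi
    have h2 : ((pair P ρ i : ℤ) : ℝ) < N := by exact_mod_cast hlt i
    change 0 < (1 / N : ℝ) * ((pair P ρ i : ℤ) : ℝ) ∧ (1 / N : ℝ) * ((pair P ρ i : ℤ) : ℝ) < 1
    constructor
    · positivity
    · rw [one_div, inv_mul_lt_iff₀ hN0, mul_one]
      exact h2
  · ext x
    constructor
    · intro hx i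
      rw [fundFloor]
      split_ifs with hi
      · simpa using hx i hi
      · have := hx _ ((isPos_negIdx b i).2 hi)
        rw [coroot_negIdx, map_neg] at this
        push_cast
        constructor <;> linarith
    · intro hx i hi
      have := hx i
      rw [fundFloor, if_pos hi] at this
      simpa using this

/-! ### Reduced alcove paths -/

lemma exists_isAlcovePath {n : ℕ} (C : ℕ → Set (Y →+ ℝ))
    (hC : ∀ m < n, ∃ i d, Crosses P i d (C m) (C (m + 1))) :
    ∃ (β : Fin n → ι) (d : Fin n → ℤ), IsAlcovePath P β d (C 0) (C n) := by
  choose β d h using fun m : Fin n ↦ hC m m.2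
  exact ⟨β, d, fun m ↦ C m, rfl, by simp, fun j ↦ by simpa using h j⟩

/-- If an alcove path crosses a hyperplane in both directions, then reflecting the part of the path
between the two crossings leads to a path that is shorter by two steps. -/
lemma exists_shorter_walk [Finite ι] [P.IsReduced] [Module.Free ℤ X] {l p q : ℕ}
    {C : ℕ → Set (Y →+ ℝ)} (hC : ∀ m < l, ∃ i d, Crosses P i d (C m) (C (m + 1)))
    (hpq : p < q) (hq : q < l) {i : ι} {d : ℤ} (h1 : Crosses P i d (C p) (C (p + 1)))
    (h2 : Crosses P (negIdx P i) (-d) (C q) (C (q + 1))) :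
    ∃ C' : ℕ → Set (Y →+ ℝ), C' 0 = C 0 ∧ C' (l - 2) = C l ∧
      ∀ m < l - 2, ∃ i d, Crosses P i d (C' m) (C' (m + 1)) := by
  classical
  have e2 : reflPoint P i d '' C q = C (q + 1) := by
    rw [← reflPoint_negIdx]
    exact h2.image_reflPoint_eq
  have e1 : reflPoint P i d '' C (p + 1) = C p := by
    rw [← h1.image_reflPoint_eq, Set.image_image]
    simp [reflPoint_reflPoint]
  set C' : ℕ → Set (Y →+ ℝ) := fun m ↦
    if m ≤ p then C m else if m < q then reflPoint P i d '' C (m + 1) else C (m + 2) with hC'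
  have a1 : ∀ m, m ≤ p → C' m = C m := fun m hm ↦ if_pos hm
  have a2 : ∀ m, p ≤ m → m < q → C' m = reflPoint P i d '' C (m + 1) := by
    intro m hm hm'
    rcases hm.eq_or_lt with rfl | hm
    · rw [a1 p le_rfl, e1]
    · simp [hC', hm.not_ge, hm']
  have a3 : ∀ m, q ≤ m + 1 → C' m = C (m + 2) := by
    intro m hm
    rcases hm.eq_or_lt with hm | hm
    · rw [a2 m (by omega) (by omega), ← hm, e2, hm]
    · simp only [hC']
      rw [if_neg (by omega), if_neg (by omega)]
  refine ⟨C', a1 0 (Nat.zero_le _), ?_, fun m hm ↦ ?_⟩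
  · rw [a3 _ (by omega)]
    congr 1
    omega
  · by_cases h3 : m + 1 ≤ p
    · rw [a1 m (by omega), a1 _ h3]
      exact hC m (by omega)
    by_cases h4 : m + 1 < q
    · rw [a2 m (by omega) (by omega), a2 _ (by omega) h4]
      obtain ⟨i', d', h⟩ := hC (m + 1) (by omega)
      exact h.image_reflPoint i d
    · rw [a3 m (by omega), a3 _ (by omega)]
      exact hC (m + 2) (by omega)

/-- The floor functions of the alcoves of a reduced path from `𝔄` to `𝔄 + λ`, and the positivity of
the roots of the path. -/
structure FloorPath (b : P.Base) (lam : X) {l : ℕ} (β : Fin l → ι) (d : Fin l → ℤ)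
    (K : ℕ → ι → ℤ) : Prop where
  zero : K 0 = fundFloor b
  last : ∀ i, K l i = fundFloor b i + pair P lam i
  neg : ∀ m ≤ l, ∀ i, K m (negIdx P i) = -1 - K m i
  pos : ∀ j, b.IsPos (β j)
  step : ∀ j : Fin l, FloorStep P (β j) (d j) (K j) (K (j + 1))
  refl : ∀ j : Fin l, K (j + 1) = reflFloor P (β j) (d j) (K j)

lemma exists_crossing {f : ℕ → ℤ} {p q : ℕ} {m : ℤ} (hpq : p ≤ q) (hp : f p < m) (hq : m ≤ f q) :
    ∃ r, p ≤ r ∧ r < q ∧ f r < m ∧ m ≤ f (r + 1) := by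
  induction q, hpq using Nat.le_induction with
  | base => omega
  | succ q hq' ih =>
    by_cases h : m ≤ f q
    · obtain ⟨r, h1, h2, h3⟩ := ih h
      exact ⟨r, h1, by omega, h3⟩
    · exact ⟨q, hq', by omega, by omega, hq⟩

lemma FloorStep.eq_of_lt_of_le {k k' : ι → ℤ} {i j : ι} {d m : ℤ} (h : FloorStep P i d k k')
    (hk : ∀ i, k (negIdx P i) = -1 - k i) (hk' : ∀ i, k' (negIdx P i) = -1 - k' i)
    (h1 : k j < m) (h2 : m ≤ k' j) : i = j ∧ d = m := by
  have hl := h.left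
  have hr := h.right
  by_cases hj : j = i
  · subst hj
    exact ⟨rfl, by omega⟩
  by_cases hj' : j = negIdx P i
  · subst hj'
    rw [hk] at h1
    rw [hk'] at h2
    omega
  · have := h.other j hj hj'
    omega

theorem IsReducedChain.exists_floorPath [Finite ι] [P.IsReduced] [Module.Free ℤ X] {lam : X}
    (hlam : ∀ i ∈ b.support, 0 ≤ pair P lam i) {l : ℕ} {β : Fin l → ι} {d : Fin l → ℤ}
    (hΓ : IsReducedChain b (-lam) (fun j ↦ negIdx P (β j)) d) :
    ∃ K, FloorPath b lam β d K := by
  obtain ⟨⟨C₀, hC0, hCl, hC⟩, hmin⟩ := hΓ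
  simp only [negIdx_negIdx, neg_neg] at hC hCl hmin
  set C : ℕ → Set (Y →+ ℝ) := fun m ↦ if h : m < l + 1 then C₀ ⟨m, h⟩ else ∅ with hCdef
  have hCc : ∀ j : Fin l, Crosses P (β j) (d j) (C j) (C (j + 1)) := by
    intro j
    have h1 : C j = C₀ j.castSucc := dif_pos (by omega)
    have h2 : C (j + 1) = C₀ j.succ := dif_pos (by omega)
    rw [h1, h2]
    exact hC j
  have hCstart : C 0 = fundamentalAlcove b := by
    rw [← hC0]
    exact dif_pos (by omega)
  have hCend : C l = translate P (fundamentalAlcove b) lam := by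
    rw [← hCl]
    exact dif_pos (by omega)
  have hF0 := isFloor_fundamentalAlcove b
  have hex : ∀ m, ∃ k, m ≤ l → IsFloor P (C m) k := by
    intro m
    rcases m with _ | m
    · exact ⟨_, fun _ ↦ hCstart ▸ hF0⟩
    · by_cases hm : m < l
      · obtain ⟨k, hk⟩ := (hCc ⟨m, hm⟩).2.1.exists_isFloor
        exact ⟨k, fun _ ↦ hk⟩
      · exact ⟨0, fun h ↦ absurd h (by omega)⟩
  choose K hK using hex
  have hKstep : ∀ j : Fin l, FloorStep P (β j) (d j) (K j) (K (j + 1)) := fun j ↦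
    (hCc j).floorStep (hK j (by omega)) (hK (j + 1) (by omega))
  have hKneg : ∀ m ≤ l, ∀ i, K m (negIdx P i) = -1 - K m i := fun m hm i ↦ (hK m hm).negIdx i
  have hK0 : K 0 = fundFloor b := (hK 0 (by omega)).unique (hCstart ▸ hF0)
  have hKl : ∀ i, K l i = fundFloor b i + pair P lam i := fun i ↦
    congrFun ((hK l le_rfl).unique (hCend ▸ hF0.translate lam)) i
  have hCwalk : ∀ m < l, ∃ i d, Crosses P i d (C m) (C (m + 1)) :=
    fun m hm ↦ ⟨_, _, hCc ⟨m, hm⟩⟩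
  -- a hyperplane cannot be crossed in both directions
  have hno : ∀ p q : Fin l, p < q → β q = negIdx P (β p) → d q = -d p → False := by
    intro p q hpq hβ hd
    have h2 := hCc q
    rw [hβ, hd] at h2
    obtain ⟨C', h3, h4, h5⟩ := exists_shorter_walk hCwalk hpq q.2 (hCc p) h2
    obtain ⟨β', d', h6⟩ := exists_isAlcovePath C' h5
    rw [h3, h4, hCstart, hCend] at h6
    have := hmin _ β' d' h6
    have := q.2
    omega
  refine ⟨K, hK0, hKl, hKneg, fun j ↦ ?_, hKstep, fun j ↦
    (hKstep j).eq_reflFloor (hK j (by omega)) (hK (j + 1) (by omega))⟩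
  by_contra hj
  set a := negIdx P (β j) with ha
  have hapos : b.IsPos a := (isPos_negIdx b _).2 hj
  have hs := (hKstep j).symm (hKneg j (by omega) _) (hKneg (j + 1) (by omega) _)
  have hja : β j = negIdx P a := by rw [ha, negIdx_negIdx]
  have h0 : K 0 a = 0 := by rw [hK0, fundFloor, if_pos hapos]
  have hl : 0 ≤ K l a := by
    rw [hKl, fundFloor, if_pos hapos, zero_add]
    exact pair_nonneg hlam hapos
  rcases lt_or_ge 0 (-d j) with hd | hd
  · obtain ⟨r, -, h1, h2, h3⟩ := exists_crossing (f := fun n ↦ K n a) (Nat.zero_le j)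
      (by simpa [h0] using hd) hs.right.ge
    obtain ⟨h4, h5⟩ := (hKstep ⟨r, by omega⟩).eq_of_lt_of_le (hKneg r (by omega))
      (hKneg (r + 1) (by omega)) h2 h3
    exact hno ⟨r, by omega⟩ j h1 (by rw [h4, hja]) (by omega)
  · obtain ⟨r, h0, h1, h2, h3⟩ := exists_crossing (f := fun n ↦ K n a) (p := j + 1) (q := l)
      (m := -d j) (by omega) (by have h : K (j + 1) a = -d j - 1 := hs.left; omega) (by omega)
    obtain ⟨h4, h5⟩ := (hKstep ⟨r, by omega⟩).eq_of_lt_of_le (hKneg r (by omega))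
      (hKneg (r + 1) (by omega)) h2 h3
    exact hno j ⟨r, by omega⟩ (by simp [Fin.lt_def]; omega) h4 h5

end

section

variable {b : P.Base}

/-! ### The field of fractions of `ℤ[X][t]` -/

lemma expo_zero : expo (0 : X) = 1 := by
  rw [expo, ← AddMonoidAlgebra.one_def, map_one]

lemma expo_add (μ ν : X) : expo (μ + ν) = expo μ * expo ν := by
  rw [expo, expo, expo, ← map_mul, AddMonoidAlgebra.single_mul_single, mul_one]

lemma expo_injective : Function.Injective (expo : X → WeightRing X) := fun μ ν h ↦ by
  have h' := Polynomial.C_injective h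
  exact AddMonoidAlgebra.single_left_injective one_ne_zero h'

lemma actRing_expo (w : P.weylGroup) (μ : X) : actRing w (expo μ) = expo (w • μ) := by
  simp [actRing, expo]

lemma actRing_X (w : P.weylGroup) : actRing w (Polynomial.X : WeightRing X) = Polynomial.X := by
  simp [actRing]

/-- The element `x^μ` of the field of fractions. -/
def fexp (μ : X) : WeightField X := algebraMap (WeightRing X) (WeightField X) (expo μ)

variable (X) in
/-- The element `t` of the field of fractions. -/
def tvar : WeightField X := algebraMap (WeightRing X) (WeightField X) Polynomial.X

lemma algebraMap_weightRing_injective :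
    Function.Injective (algebraMap (WeightRing X) (WeightField X)) :=
  IsFractionRing.injective _ _

@[simp]
lemma fexp_zero : fexp (0 : X) = 1 := by
  rw [fexp, expo_zero, map_one]

lemma fexp_add (μ ν : X) : fexp (μ + ν) = fexp μ * fexp ν := by
  rw [fexp, expo_add, map_mul, fexp, fexp]

lemma fexp_injective : Function.Injective (fexp : X → WeightField X) :=
  algebraMap_weightRing_injective.comp expo_injective

lemma actField_algebraMap (w : P.weylGroup) (f : WeightRing X) :
    actField w (algebraMap (WeightRing X) (WeightField X) f) =
      algebraMap (WeightRing X) (WeightField X) (actRing w f) :=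
  IsFractionRing.ringEquivOfRingEquiv_algebraMap _ _

@[simp]
lemma actField_fexp (w : P.weylGroup) (μ : X) : actField w (fexp μ) = fexp (w • μ) := by
  rw [fexp, actField_algebraMap, actRing_expo, fexp]

@[simp]
lemma actField_tvar (w : P.weylGroup) : actField w (tvar X) = tvar X := by
  rw [tvar, actField_algebraMap, actRing_X]

lemma actRing_mul (w w' : P.weylGroup) (f : WeightRing X) :
    actRing (w * w') f = actRing w (actRing w' f) := by
  have : (actRing (w * w') : WeightRing X →+* WeightRing X) =
      (actRing w : WeightRing X →+* WeightRing X).comp (actRing w') := by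
    refine Polynomial.ringHom_ext' (AddMonoidAlgebra.ringHom_ext ?_ ?_) ?_
    · intro r
      simp [actRing]
    · intro μ
      have := actRing_expo (w * w') μ
      have h2 := actRing_expo w' μ
      have h3 := actRing_expo w (w' • μ)
      rw [mul_smul] at this
      simp only [RingHom.comp_apply, RingHom.coe_coe]
      change actRing (w * w') (expo μ) = actRing w (actRing w' (expo μ))
      rw [this, h2, h3]
    · simp [actRing_X]
  exact RingHom.congr_fun this f

lemma actField_mul (w w' : P.weylGroup) (f : WeightField X) :
    actField (w * w') f = actField w (actField w' f) := by
  have : (actField (w * w') : WeightField X →+* WeightField X) =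
      (actField w : WeightField X →+* WeightField X).comp (actField w') := by
    refine IsLocalization.ringHom_ext (nonZeroDivisors (WeightRing X)) (RingHom.ext fun f ↦ ?_)
    simp [actField_algebraMap, actRing_mul]
  exact RingHom.congr_fun this f

lemma actField_one (f : WeightField X) : actField (1 : P.weylGroup) f = f :=
  (actField (1 : P.weylGroup)).injective (by rw [← actField_mul, one_mul])

lemma actField_refl_refl (i : ι) (f : WeightField X) :
    actField (refl P i) (actField (refl P i) f) = f := by
  rw [← actField_mul, refl_mul_self, actField_one]

lemma fexp_ne_zero (μ : X) : fexp μ ≠ 0 := fun h ↦ by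
  have h1 := fexp_add μ (-μ)
  rw [h, zero_mul, add_neg_cancel, fexp_zero] at h1
  exact one_ne_zero h1

variable [Module.Free ℤ X]

lemma fexp_neg (μ : X) : fexp (-μ) = (fexp μ)⁻¹ := by
  refine eq_inv_of_mul_eq_one_left ?_
  rw [← fexp_add, neg_add_cancel, fexp_zero]

instance : CharZero (WeightField X) := by
  have h1 : CharZero (AddMonoidAlgebra ℤ X) :=
    charZero_of_injective_algebraMap (R := ℤ) fun m n h ↦ by
      exact AddMonoidAlgebra.single_right_injective (m := (0 : X)) h
  have h2 : CharZero (WeightRing X) :=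
    charZero_of_injective_ringHom (Polynomial.C_injective (R := AddMonoidAlgebra ℤ X))
  exact charZero_of_injective_ringHom (algebraMap_weightRing_injective (X := X))

/-! ### Demazure–Lusztig coefficients -/

variable (P) in
/-- The factor `(1 - t x^{-α}) / (1 - x^{-α})` of the Hall–Littlewood polynomial. -/
def cfac (i : ι) : WeightField X := (1 - tvar X * fexp (-P.root i)) / (1 - fexp (-P.root i))

variable (P) in
/-- The coefficient `(1 - t) / (1 - x^{-α})`. For a simple root `α`, the operator
`f ↦ gfac α * f + cfac (-α) * s_α f` is a Demazure–Lusztig operator. -/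
def gfac (i : ι) : WeightField X := (1 - tvar X) / (1 - fexp (-P.root i))

omit [Module.Free ℤ X] in
lemma one_sub_fexp_ne_zero (i : ι) : 1 - fexp (-P.root i) ≠ 0 := by
  rw [sub_ne_zero, ← fexp_zero]
  intro h
  exact P.ne_zero i (neg_eq_zero.1 (fexp_injective h).symm)

lemma actField_cfac (w : P.weylGroup) (i : ι) : actField w (cfac P i) = cfac P (w • i) := by
  simp [cfac, root_smul]

lemma actField_gfac (w : P.weylGroup) (i : ι) : actField w (gfac P i) = gfac P (w • i) := by
  simp [gfac, root_smul]

lemma gfac_mul (i : ι) : gfac P i * (1 - fexp (-P.root i)) = 1 - tvar X :=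
  div_mul_cancel₀ _ (one_sub_fexp_ne_zero i)

lemma tvar_add_gfac (i : ι) : tvar X + gfac P i = cfac P i := by
  have h1 := one_sub_fexp_ne_zero (P := P) i
  rw [gfac, cfac]
  field_simp
  ring

lemma one_sub_fexp_ne_zero' (i : ι) : 1 - (fexp (-P.root i))⁻¹ ≠ 0 := by
  have h2 := one_sub_fexp_ne_zero (P := P) (negIdx P i)
  rwa [root_negIdx, fexp_neg] at h2

lemma gfac_negIdx (i : ι) : gfac P (negIdx P i) = -(fexp (-P.root i) * gfac P i) := by
  have h1 := one_sub_fexp_ne_zero (P := P) i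
  have h2 := one_sub_fexp_ne_zero' (P := P) i
  have h3 := fexp_ne_zero (-P.root i)
  rw [gfac, gfac, root_negIdx, fexp_neg (-P.root i)]
  generalize fexp (-P.root i) = y at *
  have h4 : y - 1 ≠ 0 := fun h ↦ h1 (by linear_combination -h)
  have h5 : 1 - y⁻¹ = -(1 - y) / y := by
    field_simp
    ring
  rw [h5]
  field_simp

lemma gfac_add_cfac_negIdx (i : ι) : gfac P i + cfac P (negIdx P i) = 1 := by
  rw [← tvar_add_gfac, gfac_negIdx]
  linear_combination gfac_mul (P := P) i

lemma gfac_sq_add (i : ι) :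
    fexp (-P.root i) * gfac P i ^ 2 + cfac P i * cfac P (negIdx P i) = tvar X := by
  rw [← tvar_add_gfac, ← tvar_add_gfac, gfac_negIdx]
  linear_combination tvar X * gfac_mul (P := P) i

/-! ### Compatible families -/

variable (b) in
/-- A family `f` of elements of the field, indexed by the Weyl group, is compatible with the floor
function `k` of an alcove if `f (s_i w)`, for `w < s_i w`, is obtained from `f w` by a
Demazure–Lusztig operator that is twisted by `k`. For a point `p` of the alcove, this operator
approximates the conjugate of the Demazure–Lusztig operator by multiplication with `x^{w p}`, the
exponent `⟨p, γ^∨⟩` being rounded down. -/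
def Compat (k : ι → ℤ) (f : P.weylGroup → WeightField X) : Prop :=
  ∀ i ∈ b.support, ∀ w : P.weylGroup, b.IsPos (w⁻¹ • i) →
    f (refl P i * w) = fexp (k (w⁻¹ • i) • P.root i) * gfac P i * f w +
      cfac P (negIdx P i) * actField (refl P i) (f w)

lemma Compat.congr {k k' : ι → ℤ} {f : P.weylGroup → WeightField X} (h : Compat b k f)
    (hk : ∀ i, b.IsPos i → k i = k' i) : Compat b k' f := fun i hi w hw ↦ by
  rw [h i hi w hw, hk _ hw]

lemma compat_one : Compat b 0 (1 : P.weylGroup → WeightField X) := fun i _ w _ ↦ by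
  simp [gfac_add_cfac_negIdx]

/-- Multiplication with the powers `x^{wλ}` removes the twist by the weight `λ`. -/
lemma Compat.twist {lam : X} {f : P.weylGroup → WeightField X} (h : Compat b (pair P lam) f) :
    Compat b 0 (fun w ↦ fexp (w • lam) * f w) := by
  intro i hi w hw
  have e : fexp (w • lam) =
      fexp ((refl P i * w) • lam) * fexp (pair P lam (w⁻¹ • i) • P.root i) := by
    rw [← fexp_add, mul_smul, refl_smul, pair_inv_smul, sub_add_cancel]
  have e2 : actField (refl P i) (fexp (w • lam)) = fexp ((refl P i * w) • lam) := by
    rw [actField_fexp, mul_smul]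
  simp only [h i hi w hw, map_mul, e2, Pi.zero_apply, zero_smul, fexp_zero]
  linear_combination (-gfac P i * f w) * e

variable (b) in
open Classical in
/-- The operator on families that belongs to the crossing of the wall `H_{β,d}`: either the path
goes through, or it is folded, which requires `w s_β < w`. -/
def pathStep (i : ι) (d : ℤ) (f : P.weylGroup → WeightField X) (w : P.weylGroup) : WeightField X :=
  f w + if b.IsPos (w • i) then 0 else
    (1 - tvar X) * tvar X ^ ((len b w - len b (w * refl P i) - 1) / 2) *
      fexp (-(d • P.root (w • i))) * f (w * refl P i)

omit [Module.Free ℤ X] in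
lemma pathStep_of_isPos {i : ι} (d : ℤ) (f : P.weylGroup → WeightField X) {w : P.weylGroup}
    (h : b.IsPos (w • i)) : pathStep b i d f w = f w := by
  rw [pathStep, if_pos h, add_zero]

omit [Module.Free ℤ X] in
lemma pathStep_of_not_isPos {i : ι} (d : ℤ) (f : P.weylGroup → WeightField X) {w : P.weylGroup}
    (h : ¬ b.IsPos (w • i)) : pathStep b i d f w =
      f w + (1 - tvar X) * tvar X ^ ((len b w - len b (w * refl P i) - 1) / 2) *
        fexp (-(d • P.root (w • i))) * f (w * refl P i) := by
  rw [pathStep, if_neg h]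

/-- Crossing a wall preserves compatibility. For the simple root `α_i` and `γ = w⁻¹ α_i`, the case
`γ = β` is the one where the floor at `γ` changes. In the other cases the compatibility at `w s_β`
is used, and, if `s_β γ` is negative, the quadratic relation of the Demazure–Lusztig operator. -/
lemma Compat.pathStep [Finite ι] [P.IsReduced] {β : ι} (hβ : b.IsPos β) {d : ℤ} {k k' : ι → ℤ}
    (hk : FloorStep P β d k k') (hk' : k' = reflFloor P β d k)
    (hneg : ∀ i, k (negIdx P i) = -1 - k i) {f : P.weylGroup → WeightField X}
    (h : Compat b k f) : Compat b k' (pathStep b β d f) := by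
  intro i hi w hw
  have hipos := RootPairing.Base.isPos_of_mem_support hi
  have hlen := len_refl_mul_of_isPos hi hw
  set γ := w⁻¹ • i with hγ
  have hwγ : w • γ = i := smul_inv_smul w i
  by_cases hγβ : γ = β
  · rw [hγβ] at hwγ
    have h1 : refl P i * w * refl P β = w := by
      rw [mul_refl_eq, mul_smul, hwγ, refl_smul_self, refl_negIdx, refl_mul_refl_mul]
    have h2 : (refl P i * w) • β = negIdx P i := by rw [mul_smul, hwγ, refl_smul_self]
    have h3 := h i hi w hw
    rw [← hγ, hγβ, hk.left] at h3
    have h4 : fexp ((d - 1) • P.root i) = fexp (d • P.root i) * fexp (-P.root i) := by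
      rw [← fexp_add]
      congr 1
      module
    have h6 : ¬ b.IsPos ((refl P i * w) • β) := by
      rw [h2, isPos_negIdx]
      exact not_not.2 hipos
    rw [pathStep_of_not_isPos d f h6, pathStep_of_isPos d f (by rwa [hwγ]), h1, h2, hγβ,
      hk.right, h3, hlen, root_negIdx, h4]
    have h5 : (len b w + 1 - len b w - 1) / 2 = 0 := by simp
    rw [h5, smul_neg, neg_neg]
    linear_combination (-fexp (d • P.root i) * f w) * gfac_mul (P := P) i
  · have hγβ' : γ ≠ negIdx P β := ne_negIdx_of_isPos b hw hβ
    have h1 : w • β ≠ i := fun h' ↦ hγβ (by rw [hγ, ← h', inv_smul_smul])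
    have h2 : w • β ≠ negIdx P i := fun h' ↦ hγβ' (by
      rw [hγ, ← negIdx_negIdx (P := P) i, ← h', smul_negIdx, inv_smul_smul])
    have h3 : b.IsPos ((refl P i * w) • β) ↔ b.IsPos (w • β) := by
      rw [mul_smul]
      exact isPos_refl_smul_iff hi h1 h2
    have h4 := h i hi w hw
    rw [← hγ, hk.other γ hγβ hγβ'] at h4
    by_cases h5 : b.IsPos (w • β)
    · rw [pathStep_of_isPos d f h5, pathStep_of_isPos d f (h3.2 h5)]
      exact h4
    · have h6 := len_mul_refl_lt hβ h5
      set v := w * refl P β with hv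
      set m := pair P (P.root β) γ with hm
      set E := fexp (-(d • P.root (w • β))) with hE
      set A := fexp ((d * m) • P.root i) with hA
      set δ := refl P β • γ with hδ
      have hvδ : v⁻¹ • i = δ := by rw [hv, mul_inv_rev, refl_inv, mul_smul]
      have hassoc : refl P i * w * refl P β = refl P i * v := mul_assoc _ _ _
      have hE' : fexp (-(d • P.root ((refl P i * w) • β))) = E * A := by
        rw [hE, hA, ← fexp_add, mul_smul, root_smul, refl_smul, hm, hγ, pair_inv_smul,
          ← root_smul]
        congr 1
        module
      have hactE : actField (refl P i) E = E * A := by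
        rw [hE, actField_fexp, ← hE', smul_neg, smul_zsmul_weight, ← root_smul, mul_smul]
      have hkγ : k' γ = k δ + d * m := by rw [hk', reflFloor]
      have hZ : fexp (k' γ • P.root i) = fexp (k δ • P.root i) * A := by
        rw [hkγ, hA, ← fexp_add]
        congr 1
        module
      rw [pathStep_of_not_isPos d f h5, pathStep_of_not_isPos d f (fun h' ↦ h5 (h3.1 h'))]
      simp only [hassoc, ← hv, hE', ← hE, map_add,
        map_mul, map_sub, map_one, map_pow, actField_tvar, hactE, h4, hlen]
      by_cases h7 : b.IsPos δ
      · have h8 := h i hi v (by rwa [hvδ])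
        rw [hvδ] at h8
        have h9 := len_refl_mul_of_isPos hi (w := v) (by rwa [hvδ])
        have h10 : (len b w + 1 - len b (refl P i * v) - 1) / 2 =
            (len b w - len b v - 1) / 2 := by
          congr 1
          omega
        rw [h10, h8, hZ]
        ring
      · set v' := refl P i * v with hv'
        have h8 : v = refl P i * v' := by rw [hv', refl_mul_refl_mul]
        have h9 : v'⁻¹ • i = negIdx P δ := by rw [hv', refl_mul_inv_smul_self, hvδ]
        have h10 := h i hi v' (by rw [h9, isPos_negIdx]; exact h7)
        rw [← h8, h9] at h10
        have h11 := len_refl_mul_of_not_isPos hi (w := v) (by rwa [hvδ])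
        rw [← hv'] at h11
        have h12 : (len b w + 1 - len b v' - 1) / 2 = (len b w - len b v - 1) / 2 + 1 := by
          omega
        set Z := fexp (k δ • P.root i) with hZdef
        set y := fexp (-P.root i) with hy
        have hy0 : y ≠ 0 := fexp_ne_zero _
        have hZ0 : Z ≠ 0 := fexp_ne_zero _
        have hkn : fexp (k (negIdx P δ) • P.root i) = y * Z⁻¹ := by
          rw [hneg, hy, hZdef, ← fexp_neg, ← fexp_add]
          congr 1
          module
        have hyinv : actField (refl P i) y = y⁻¹ := by
          rw [hy, actField_fexp, ← fexp_neg, smul_neg, ← root_smul, refl_smul_self, root_negIdx]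
        have hZinv : actField (refl P i) Z = Z⁻¹ := by
          rw [hZdef, actField_fexp, ← fexp_neg, smul_zsmul_weight, ← root_smul, refl_smul_self,
            root_negIdx, smul_neg]
        have h13 : actField (refl P i) (f v) = y⁻¹ * Z * gfac P (negIdx P i) *
            actField (refl P i) (f v') + cfac P i * f v' := by
          rw [h10, hkn]
          simp only [map_add, map_mul, map_inv₀, hyinv, hZinv, actField_gfac, actField_cfac,
            actField_refl_refl, refl_smul_self, smul_negIdx, negIdx_negIdx, inv_inv]
        rw [h12, hZ, h13, h10, hkn, gfac_negIdx, ← hy, pow_succ]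
        have q := gfac_sq_add (P := P) i
        rw [← hy] at q
        field_simp
        linear_combination (-(1 - tvar X) * tvar X ^ ((len b w - len b v - 1) / 2) * E * A *
          f v') * q

variable (b) in
/-- The composition of the operators that belong to the crossings of an alcove path. -/
def pathProd : (l : ℕ) → (Fin l → ι) → (Fin l → ℤ) → (P.weylGroup → WeightField X) →
    P.weylGroup → WeightField X
  | 0, _, _, f => f
  | l + 1, β, d, f => pathStep b (β (Fin.last l)) (d (Fin.last l))
      (pathProd l (fun j ↦ β j.castSucc) (fun j ↦ d j.castSucc) f)

lemma Compat.pathProd [Finite ι] [P.IsReduced] {l : ℕ} {β : Fin l → ι} {d : Fin l → ℤ}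
    {K : ℕ → ι → ℤ} (hneg : ∀ m ≤ l, ∀ i, K m (negIdx P i) = -1 - K m i)
    (hpos : ∀ j, b.IsPos (β j))
    (hstep : ∀ j : Fin l, FloorStep P (β j) (d j) (K j) (K (j + 1)))
    (hrefl : ∀ j : Fin l, K (j + 1) = reflFloor P (β j) (d j) (K j))
    {f : P.weylGroup → WeightField X} (h : Compat b (K 0) f) :
    Compat b (K l) (pathProd b l β d f) := by
  induction l with
  | zero => exact h
  | succ l ih =>
    have := ih (β := fun j ↦ β j.castSucc) (d := fun j ↦ d j.castSucc)
      (fun m hm ↦ hneg m (by omega)) (fun j ↦ hpos _) (fun j ↦ hstep j.castSucc)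
      (fun j ↦ hrefl j.castSucc)
    exact this.pathStep (hpos _) (hstep (Fin.last l)) (hrefl (Fin.last l)) (hneg l (by omega))

omit [Module.Free ℤ X] in
lemma pathProd_apply_one {l : ℕ} {β : Fin l → ι} (d : Fin l → ℤ) (hpos : ∀ j, b.IsPos (β j))
    (f : P.weylGroup → WeightField X) : pathProd b l β d f 1 = f 1 := by
  induction l with
  | zero => rfl
  | succ l ih =>
    rw [pathProd, pathStep_of_isPos _ _ (by rw [one_smul]; exact hpos _)]
    exact ih _ fun j ↦ hpos _

end

section

variable {b : P.Base}

/-! ### Minimal coset representatives -/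

lemma isPos_of_mem_closure {i : ι} (h : P.root i ∈ AddSubmonoid.closure (P.root '' b.support)) :
    b.IsPos i := by
  have key : ∀ m ∈ AddSubmonoid.closure (P.root '' b.support),
      ∃ f : ι → ℕ, m = ∑ j ∈ b.support, f j • P.root j := by
    classical
    intro m hm
    induction hm using AddSubmonoid.closure_induction with
    | mem x hx =>
      obtain ⟨j, hj, rfl⟩ := hx
      refine ⟨fun k ↦ if k = j then 1 else 0, ?_⟩
      have hj' : j ∈ b.support := hj
      simp [ite_smul, hj']
    | zero => exact ⟨0, by simp⟩
    | add x y _ _ hx hy =>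
      obtain ⟨f, rfl⟩ := hx
      obtain ⟨g, rfl⟩ := hy
      exact ⟨f + g, by simp [add_smul, Finset.sum_add_distrib]⟩
  obtain ⟨f, hf⟩ := key _ h
  have h1 : P.root i = ∑ j ∈ b.support, (fun j ↦ (f j : ℤ)) j • P.root j := by
    simpa using hf
  rw [RootPairing.Base.isPos_iff', RootPairing.Base.height_eq_sum h1]
  exact Finset.sum_nonneg (by simp)

lemma mem_closure_of_isPos {i : ι} (h : b.IsPos i) :
    P.root i ∈ AddSubmonoid.closure (P.root '' b.support) := by
  obtain ⟨f, hf⟩ := exists_root_eq_nat_sum h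
  have h1 : ∀ j ∈ b.support, P.root j ∈ AddSubmonoid.closure (P.root '' b.support) :=
    fun j hj ↦ AddSubmonoid.subset_closure ⟨j, hj, rfl⟩
  rw [hf]
  exact sum_mem fun j hj ↦ nsmul_mem (h1 j hj) _

/-- If `w` keeps the simple roots orthogonal to `λ` positive, then it keeps all positive roots
orthogonal to `λ` positive. -/
lemma isPos_smul_of_pair_eq_zero [Finite ι] {lam : X}
    (hlam : ∀ i ∈ b.support, 0 ≤ pair P lam i) {w : P.weylGroup}
    (hw : ∀ j ∈ simpleStab b lam, b.IsPos (w • j)) {i : ι} (hi : b.IsPos i)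
    (h0 : pair P lam i = 0) : b.IsPos (w • i) := by
  obtain ⟨N, φ, h⟩ := exists_linear_pair P lam
  obtain ⟨f, hf⟩ := exists_root_eq_nat_sum hi
  have h1 := (h i).2
  rw [h0, mul_zero, hf, map_sum, Finset.sum_eq_zero_iff_of_nonneg] at h1
  · refine isPos_of_mem_closure ?_
    rw [root_smul, hf, Finset.smul_sum]
    refine sum_mem fun j hj ↦ ?_
    have h2 := h1 j hj
    rw [map_nsmul, (h j).2, smul_eq_zero, mul_eq_zero, or_iff_right (h j).1.ne'] at h2
    rw [smul_comm, ← root_smul]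
    rcases h2 with h2 | h2
    · simp [h2]
    · exact nsmul_mem (mem_closure_of_isPos (hw j ⟨hj, h2⟩)) _
  · intro j hj
    rw [map_nsmul, (h j).2]
    exact nsmul_nonneg (mul_nonneg (h j).1.le (hlam j hj)) _

lemma stabGroup_smul {lam : X} {v : P.weylGroup} (hv : v ∈ stabGroup b lam) : v • lam = lam := by
  have h : stabGroup b lam ≤ MulAction.stabilizer P.weylGroup lam := by
    rw [stabGroup, Subgroup.closure_le]
    rintro - ⟨j, hj, rfl⟩
    change refl P j • lam = lam
    rw [refl_smul, pair, hj.2, zero_smul, sub_zero]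
  exact h hv

lemma isPos_of_pair_pos [Finite ι] {lam : X} (hlam : ∀ i ∈ b.support, 0 ≤ pair P lam i) {i : ι}
    (h : 0 < pair P lam i) : b.IsPos i := by
  by_contra hn
  have := pair_nonneg hlam ((isPos_negIdx b i).2 hn)
  rw [pair_negIdx] at this
  omega

lemma pair_smul_of_smul_eq {lam : X} {v w : P.weylGroup} (h : v • lam = w • lam) (i : ι) :
    pair P lam (w⁻¹ • v • i) = pair P lam i := by
  rw [pair_inv_smul, ← h, pair_smul]

variable [Finite ι] [P.IsReduced]

lemma isPos_smul_of_mem_minReps {lam : X} {w : P.weylGroup} (hw : w ∈ minReps b lam) {j : ι}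
    (hj : j ∈ simpleStab b lam) : b.IsPos (w • j) := by
  by_contra hn
  have h1 := hw (refl P j) (Subgroup.subset_closure ⟨j, hj, rfl⟩)
  have h2 := len_mul_refl_lt (RootPairing.Base.isPos_of_mem_support hj.1) hn
  omega

lemma eq_of_smul_eq {lam : X} (hlam : ∀ i ∈ b.support, 0 ≤ pair P lam i) {v w : P.weylGroup}
    (hv : ∀ j ∈ simpleStab b lam, b.IsPos (v • j)) (hw : ∀ j ∈ simpleStab b lam, b.IsPos (w • j))
    (h : v • lam = w • lam) : v = w := by
  by_contra hne
  have hne' : v⁻¹ * w ≠ 1 := fun h1 ↦ hne (inv_mul_eq_one.1 h1)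
  obtain ⟨i, hi, hlt⟩ := exists_refl_mul_of_ne_one (b := b) hne'
  have hneg : ¬ b.IsPos ((v⁻¹ * w)⁻¹ • i) := fun h' ↦ by
    have := len_refl_mul_of_isPos hi h'
    omega
  rw [mul_inv_rev, inv_inv, mul_smul] at hneg
  have hneg' := (isPos_negIdx b _).2 hneg
  have h1 := pair_smul_of_smul_eq h i
  have h2 := pair_nonneg hlam hneg'
  rw [pair_negIdx, h1] at h2
  have h3 : pair P lam i = 0 := le_antisymm (by omega) (hlam i hi)
  have h4 := isPos_smul_of_pair_eq_zero hlam hw hneg' (by rw [pair_negIdx, h1, h3, neg_zero])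
  rw [smul_negIdx, smul_inv_smul, isPos_negIdx] at h4
  exact h4 (hv i ⟨hi, h3⟩)

omit [P.IsReduced] in
lemma exists_mem_minReps_smul_eq (b : P.Base) (lam : X) (v : P.weylGroup) :
    ∃ w ∈ minReps b lam, w • lam = v • lam := by
  obtain ⟨w, hw, hmin⟩ := Set.exists_min_image {w : P.weylGroup | w • lam = v • lam} (len b)
    (Set.toFinite _) ⟨v, rfl⟩
  refine ⟨w, fun u hu ↦ hmin _ ?_, hw⟩
  change (w * u) • lam = v • lam
  rw [mul_smul, stabGroup_smul hu]
  exact hw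

lemma mem_minReps_iff {lam : X} (hlam : ∀ i ∈ b.support, 0 ≤ pair P lam i) {w : P.weylGroup} :
    w ∈ minReps b lam ↔ ∀ j ∈ simpleStab b lam, b.IsPos (w • j) := by
  refine ⟨fun h j hj ↦ isPos_smul_of_mem_minReps h hj, fun h ↦ ?_⟩
  obtain ⟨u, hu, hul⟩ := exists_mem_minReps_smul_eq b lam w
  rwa [← eq_of_smul_eq hlam (fun j hj ↦ isPos_smul_of_mem_minReps hu hj) h hul]

lemma eq_of_mem_minReps {lam : X} (hlam : ∀ i ∈ b.support, 0 ≤ pair P lam i) {v w : P.weylGroup}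
    (hv : v ∈ minReps b lam) (hw : w ∈ minReps b lam) (h : v • lam = w • lam) : v = w :=
  eq_of_smul_eq hlam ((mem_minReps_iff hlam).1 hv) ((mem_minReps_iff hlam).1 hw) h

variable (b) in
/-- The finite set `R⁺ ∖ R⁺_λ`. -/
def outerFinset (lam : X) : Finset ι := (Set.toFinite (outerRoots b lam)).toFinset

omit [P.IsReduced] in
lemma mem_outerFinset {lam : X} (hlam : ∀ i ∈ b.support, 0 ≤ pair P lam i) {i : ι} :
    i ∈ outerFinset b lam ↔ b.IsPos i ∧ 0 < pair P lam i := by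
  rw [outerFinset, Set.Finite.mem_toFinset, mem_outerRoots_iff hlam]

omit [P.IsReduced] in
lemma card_outerFinset (lam : X) : (outerFinset b lam).card = dimFlag b lam :=
  (Set.ncard_eq_toFinset_card _ _).symm

omit [Finite ι] [P.IsReduced] in
lemma negIdx_smul_injective (w : P.weylGroup) :
    Function.Injective (fun i ↦ negIdx P (w • i)) := fun i j h ↦ by
  have h' := congrArg (negIdx P) h
  simp only [negIdx_negIdx] at h'
  exact MulAction.injective w h'

lemma len_le_dimFlag {lam : X} (hlam : ∀ i ∈ b.support, 0 ≤ pair P lam i) {w : P.weylGroup}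
    (hw : w ∈ minReps b lam) : len b w ≤ dimFlag b lam := by
  rw [len_eq_card_inversions, ← card_outerFinset]
  refine Finset.card_le_card_of_injOn (fun i ↦ negIdx P (w⁻¹ • i)) (fun i hi ↦ ?_)
    (negIdx_smul_injective _).injOn
  obtain ⟨h1, h2⟩ := mem_inversions.1 hi
  have h3 := (isPos_negIdx b _).2 h2
  refine (mem_outerFinset hlam).2 ⟨h3, lt_of_le_of_ne (pair_nonneg hlam h3) fun h0 ↦ ?_⟩
  have := isPos_smul_of_pair_eq_zero hlam ((mem_minReps_iff hlam).1 hw) h3 h0.symm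
  rw [smul_negIdx, smul_inv_smul, isPos_negIdx] at this
  exact this h1

lemma dimFlag_le_len {lam : X} (hlam : ∀ i ∈ b.support, 0 ≤ pair P lam i) {v : P.weylGroup}
    (hv : ∀ i ∈ outerFinset b lam, ¬ b.IsPos (v • i)) : dimFlag b lam ≤ len b v := by
  rw [len_eq_card_inversions, ← card_outerFinset]
  refine Finset.card_le_card_of_injOn (fun i ↦ negIdx P (v • i)) (fun i hi ↦ ?_)
    (negIdx_smul_injective _).injOn
  refine mem_inversions.2 ⟨(isPos_negIdx b _).2 (hv i hi), ?_⟩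
  rw [smul_negIdx, inv_smul_smul, isPos_negIdx, not_not]
  exact ((mem_outerFinset hlam).1 hi).1

/-- The longest element of `W^λ`. -/
lemma exists_longest_minRep {lam : X} (hlam : ∀ i ∈ b.support, 0 ≤ pair P lam i) :
    ∃ m ∈ minReps b lam, ∀ i, 0 < pair P lam i → ¬ b.IsPos (m • i) := by
  obtain ⟨w₀, -, hmax⟩ := Set.exists_max_image (Set.univ : Set P.weylGroup) (len b)
    (Set.toFinite _) ⟨1, trivial⟩
  have hw₀ : ∀ i, b.IsPos i → ¬ b.IsPos (w₀ • i) := fun i hi h ↦ by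
    have h1 := hmax (w₀ * refl P i) trivial
    have h2 := lt_len_mul_refl hi h
    omega
  obtain ⟨m, hm, hm'⟩ := exists_mem_minReps_smul_eq b lam w₀
  refine ⟨m, hm, fun i hi h ↦ ?_⟩
  have h1 := pair_smul_of_smul_eq hm' i
  have h2 := hw₀ _ (isPos_of_pair_pos hlam (h1 ▸ hi))
  rw [smul_inv_smul] at h2
  exact h2 h

variable [Module.Free ℤ X]

/-! ### Compatible families with a dominant initial value -/

omit [Finite ι] [P.IsReduced] in
lemma Compat.apply_refl_mul {f : P.weylGroup → WeightField X} (h : Compat b 0 f) {i : ι}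
    (hi : i ∈ b.support) {w : P.weylGroup} (hw : b.IsPos (w⁻¹ • i)) :
    f (refl P i * w) = gfac P i * f w + cfac P (negIdx P i) * actField (refl P i) (f w) := by
  rw [h i hi w hw]
  simp

lemma Compat.apply_mul_refl {lam : X} {f : P.weylGroup → WeightField X} (h : Compat b 0 f)
    {n : ℕ} (h1 : f 1 = fexp lam ^ n) {j : ι} (hj : j ∈ simpleStab b lam) {w : P.weylGroup}
    (hw : b.IsPos (w • j)) : f (w * refl P j) = f w := by
  have hjpos := RootPairing.Base.isPos_of_mem_support hj.1
  induction w using weyl_induction b with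
  | one =>
    have h2 := h.apply_refl_mul hj.1 (w := 1) (by simpa using hjpos)
    have h3 : actField (refl P j) (f 1) = f 1 := by
      rw [h1, map_pow, actField_fexp, refl_smul, pair, hj.2, zero_smul, sub_zero]
    rw [mul_one, h3, ← add_mul, gfac_add_cfac_negIdx, one_mul] at h2
    rw [one_mul, h2]
  | step i hi w hiw ih =>
    have h2 : w • j ≠ i := by
      intro h'
      rw [mul_smul, h', refl_smul_self, isPos_negIdx] at hw
      exact hw (RootPairing.Base.isPos_of_mem_support hi)
    have h3 : b.IsPos (w • j) := by
      rw [mul_smul, isPos_refl_smul_iff hi h2] at hw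
      · exact hw
      · intro h'
        rw [← negIdx_negIdx (P := P) i, ← h', smul_negIdx, inv_smul_smul, isPos_negIdx] at hiw
        exact hiw hjpos
    have h4 : b.IsPos ((w * refl P j)⁻¹ • i) := by
      rw [mul_inv_rev, refl_inv, mul_smul]
      exact isPos_refl_smul hj.1 hiw fun h' ↦ h2 (by rw [← h', smul_inv_smul])
    rw [mul_assoc, h.apply_refl_mul hi h4, ih h3, h.apply_refl_mul hi hiw]

omit [Finite ι] [P.IsReduced] in
lemma cfac_ne_zero (i : ι) : cfac P i ≠ 0 := by
  refine div_ne_zero (fun h ↦ ?_) (one_sub_fexp_ne_zero i)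
  have h1 : algebraMap (WeightRing X) (WeightField X)
      (1 - Polynomial.X * expo (-P.root i)) = 0 := by
    rw [map_sub, map_mul, map_one]
    exact h
  have h2 := congrArg (fun p ↦ Polynomial.coeff p 0)
    ((injective_iff_map_eq_zero _).1 algebraMap_weightRing_injective _ h1)
  simp [Polynomial.mul_coeff_zero] at h2

/-- The sum `∑_{w ∈ W^λ} t^{dim - ℓ(w)} f_w` is invariant: the elements of `W^λ` are grouped into
pairs `{w, s_i w}`, for which `t + τ_i` produces an invariant element, and elements `w` with
`s_i w ∈ w W_λ`, for which `f_w` itself is invariant. -/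
lemma Compat.actField_sum_minReps {lam : X} (hlam : ∀ i ∈ b.support, 0 ≤ pair P lam i)
    {f : P.weylGroup → WeightField X} (h : Compat b 0 f)
    {n : ℕ} (h1 : f 1 = fexp lam ^ n) (u : P.weylGroup) :
    actField u (∑ w ∈ (Set.toFinite (minReps b lam)).toFinset,
        tvar X ^ (dimFlag b lam - len b w) * f w) =
      ∑ w ∈ (Set.toFinite (minReps b lam)).toFinset,
        tvar X ^ (dimFlag b lam - len b w) * f w := by
  classical
  set F := (Set.toFinite (minReps b lam)).toFinset with hF
  have hmem : ∀ w, w ∈ F ↔ w ∈ minReps b lam := fun w ↦ by simp [hF]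
  set T : P.weylGroup → WeightField X := fun w ↦ tvar X ^ (dimFlag b lam - len b w) * f w with hT
  induction u using weyl_induction b with
  | one => rw [actField_one]
  | step i hi u _ ih =>
  rw [actField_mul, ih]
  have pairUp : ∀ w ∈ F, refl P i * w ∈ F → b.IsPos (w⁻¹ • i) →
      actField (refl P i) (T w + T (refl P i * w)) = T w + T (refl P i * w) := by
    intro w hw hw' hpos
    have h2 := len_refl_mul_of_isPos hi hpos
    have h3 := len_le_dimFlag hlam ((hmem _).1 hw')
    obtain ⟨e, he⟩ : ∃ e, dimFlag b lam - len b w = e + 1 := ⟨dimFlag b lam - len b w - 1, by omega⟩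
    have he' : dimFlag b lam - len b (refl P i * w) = e := by omega
    have h4 : T w + T (refl P i * w) = tvar X ^ e *
        (cfac P i * f w + cfac P (negIdx P i) * actField (refl P i) (f w)) := by
      simp only [hT]
      rw [he, he', h.apply_refl_mul hi hpos, ← tvar_add_gfac i]
      ring
    rw [h4]
    simp only [map_mul, map_pow, map_add, actField_tvar, actField_cfac, refl_smul_self,
      smul_negIdx, negIdx_negIdx, actField_refl_refl]
    ring
  set σ : P.weylGroup → P.weylGroup := fun w ↦ if refl P i * w ∈ F then refl P i * w else w with hσ
  have hσF : ∀ w ∈ F, σ w ∈ F := by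
    intro w hw
    simp only [hσ]
    split_ifs with h2
    exacts [h2, hw]
  have hσσ : ∀ w ∈ F, σ (σ w) = w := by
    intro w hw
    by_cases h2 : refl P i * w ∈ F
    · have : σ w = refl P i * w := if_pos h2
      rw [this]
      simp only [hσ]
      rw [refl_mul_refl_mul, if_pos hw]
    · have : σ w = w := if_neg h2
      rw [this, this]
  have hinv : ∀ w ∈ F, actField (refl P i) (T w + T (σ w)) = T w + T (σ w) := by
    intro w hw
    by_cases h2 : refl P i * w ∈ F
    · have h3 : σ w = refl P i * w := if_pos h2
      rw [h3]
      by_cases hpos : b.IsPos (w⁻¹ • i)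
      · exact pairUp w hw h2 hpos
      · have := pairUp (refl P i * w) h2 (by rwa [refl_mul_refl_mul])
          (by rwa [refl_mul_inv_smul_self, isPos_negIdx])
        rwa [refl_mul_refl_mul, add_comm] at this
    · have h3 : σ w = w := if_neg h2
      rw [h3]
      rw [hmem, mem_minReps_iff hlam] at h2
      push Not at h2
      obtain ⟨j, hj, hneg⟩ := h2
      have h4 := (mem_minReps_iff hlam).1 ((hmem w).1 hw) j hj
      have h5 : w • j = i := by
        by_contra hne
        exact hneg (by rw [mul_smul]; exact isPos_refl_smul hi h4 hne)
      have h6 : w⁻¹ • i = j := by rw [← h5, inv_smul_smul]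
      have h7 := h.apply_refl_mul hi (w := w)
        (by rw [h6]; exact RootPairing.Base.isPos_of_mem_support hj.1)
      rw [← h5, ← mul_refl_eq, h.apply_mul_refl h1 hj h4, h5] at h7
      have h8 : actField (refl P i) (f w) = f w := by
        refine mul_left_cancel₀ (cfac_ne_zero (P := P) (negIdx P i)) ?_
        linear_combination -h7 - f w * gfac_add_cfac_negIdx (P := P) i
      simp only [hT, map_add, map_mul, map_pow, actField_tvar, h8]
  have hsum : ∑ w ∈ F, T (σ w) = ∑ w ∈ F, T w :=
    Finset.sum_nbij' σ σ hσF hσF hσσ hσσ fun _ _ ↦ rfl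
  have htwo : (2 : WeightField X) * ∑ w ∈ F, T w = ∑ w ∈ F, (T w + T (σ w)) := by
    rw [Finset.sum_add_distrib, hsum, two_mul]
  have h2 : actField (refl P i) (2 * ∑ w ∈ F, T w) = 2 * ∑ w ∈ F, T w := by
    rw [htwo, map_sum]
    exact Finset.sum_congr rfl hinv
  rw [map_mul, map_ofNat] at h2
  exact mul_left_cancel₀ two_ne_zero h2

/-- The expansion of the members of compatible families in terms of the powers `x^{vλ}`, with
coefficients that are independent of the family. -/
lemma exists_coeff (b : P.Base) (lam : X) (w : P.weylGroup) : ∃ c : P.weylGroup → WeightField X,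
    (∀ (n : ℕ) (f : P.weylGroup → WeightField X), Compat b 0 f → f 1 = fexp lam ^ n →
      f w = ∑ᶠ v, c v * fexp (v • lam) ^ n) ∧
    c w = ∏ i ∈ inversions b w, cfac P (negIdx P i) ∧
    ∀ v, c v ≠ 0 → v = w ∨ len b v < len b w := by
  classical
  have := Fintype.ofFinite P.weylGroup
  simp only [finsum_eq_sum_of_fintype]
  induction w using weyl_induction b with
  | one =>
    refine ⟨Pi.single 1 1, fun n f _ hf ↦ ?_, by simp [inversions_one], fun v hv ↦ ?_⟩
    · simp [hf, Pi.single_apply]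
    · left
      by_contra hne
      exact hv (Pi.single_eq_of_ne hne _)
  | step i hi w hiw ih =>
    obtain ⟨c, h1, h2, h3⟩ := ih
    have hlen := len_refl_mul_of_isPos hi hiw
    refine ⟨fun v ↦ gfac P i * c v + cfac P (negIdx P i) * actField (refl P i) (c (refl P i * v)),
      fun n f hf hf1 ↦ ?_, ?_, fun v hv ↦ ?_⟩
    · rw [hf.apply_refl_mul hi hiw, h1 n f hf hf1, map_sum]
      simp only [add_mul, Finset.sum_add_distrib, Finset.mul_sum]
      congr 1
      · exact Finset.sum_congr rfl fun v _ ↦ by ring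
      · refine Fintype.sum_equiv (Equiv.mulLeft (refl P i)) _ _ fun v ↦ ?_
        rw [Equiv.coe_mulLeft, refl_mul_refl_mul, map_mul, map_pow, actField_fexp, mul_smul]
        ring
    · have h4 : c (refl P i * w) = 0 := by
        by_contra hne
        rcases h3 _ hne with h5 | h5
        · rw [h5] at hlen
          omega
        · omega
      beta_reduce
      rw [h4, refl_mul_refl_mul, h2, inversions_refl_mul hi hiw, Finset.prod_cons,
        Finset.prod_map, map_prod, mul_zero, zero_add]
      congr 1
      refine Finset.prod_congr rfl fun j _ ↦ ?_
      rw [actField_cfac, smul_negIdx]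
      rfl
    · by_cases h4 : c v = 0
      · have h5 : c (refl P i * v) ≠ 0 := by
          intro h5
          exact hv (by beta_reduce; rw [h4, h5, map_zero, mul_zero, mul_zero, add_zero])
        rcases h3 _ h5 with h6 | h6
        · left
          rw [← h6, refl_mul_refl_mul]
        · right
          have h7 := len_refl_mul_le hi (refl P i * v)
          rw [refl_mul_refl_mul] at h7
          omega
      · right
        rcases h3 v h4 with rfl | h5 <;> omega

omit [Finite ι] [P.IsReduced] [Module.Free ℤ X] [AddCommGroup X] [AddCommGroup Y] in
/-- Power sums determine the coefficients of the distinct values. -/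
lemma sum_filter_eq_zero_of_forall_pow {V K : Type*} [Fintype V] [Field K] [DecidableEq K]
    (B x : V → K) (h : ∀ n : ℕ, ∑ v, B v * x v ^ n = 0) (c : K) :
    ∑ v with x v = c, B v = 0 := by
  have hp : ∀ p : Polynomial K, ∑ v, B v * p.eval (x v) = 0 := by
    intro p
    simp only [Polynomial.eval_eq_sum_range, Finset.mul_sum]
    rw [Finset.sum_comm]
    refine Finset.sum_eq_zero fun n _ ↦ ?_
    have h1 := congrArg (p.coeff n * ·) (h n)
    simp only [Finset.mul_sum, mul_zero] at h1
    rw [← h1]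
    exact Finset.sum_congr rfl fun v _ ↦ by ring
  -- a polynomial that vanishes at all values other than `c`
  set q : Polynomial K :=
    ∏ y ∈ (Finset.univ.image x).erase c, (Polynomial.X - Polynomial.C y) with hq
  have hqc : q.eval c ≠ 0 := by
    rw [hq, Polynomial.eval_prod, Finset.prod_ne_zero_iff]
    intro y hy
    simpa [sub_eq_zero] using (Finset.ne_of_mem_erase hy).symm
  have h2 := hp q
  rw [← Finset.sum_filter_add_sum_filter_not _ (fun v ↦ x v = c), add_eq_left.2] at h2
  · have h3 : (∑ v with x v = c, B v) * q.eval c = 0 := by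
      rw [Finset.sum_mul, ← h2]
      refine Finset.sum_congr rfl fun v hv ↦ ?_
      rw [(Finset.mem_filter.1 hv).2]
    exact (mul_eq_zero.1 h3).resolve_right hqc
  · refine Finset.sum_eq_zero fun v hv ↦ ?_
    have h4 : q.eval (x v) = 0 := by
      rw [hq, Polynomial.eval_prod]
      refine Finset.prod_eq_zero (i := x v) ?_ (by simp)
      exact Finset.mem_erase.2 ⟨(Finset.mem_filter.1 hv).2, Finset.mem_image_of_mem _
        (Finset.mem_univ v)⟩
    rw [h4, mul_zero]

end

section

variable {b : P.Base}

/-! ### The Hall–Littlewood polynomial as a sum over a compatible family -/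

lemma hallLittlewood_eq_sum [Finite ι] [Module.Free ℤ X] (lam : X) :
    hallLittlewood b lam = ∑ w ∈ (Set.toFinite (minReps b lam)).toFinset,
      actField w (fexp lam * ∏ i ∈ outerFinset b lam, cfac P i) := by
  rw [hallLittlewood]
  refine Finset.sum_congr rfl fun w _ ↦ ?_
  congr 2
  refine Finset.prod_congr rfl fun i _ ↦ ?_
  rw [map_sub, map_sub, map_mul, map_one]
  rfl

/-- Both sides are invariant combinations of the powers `x^{vλ}`. The coefficients of the right hand
side are determined at the longest element of `W^λ`, to which only one summand contributes. They
can be compared separately since the families for all multiples of `λ` are available. -/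
theorem hallLittlewood_eq_sum_compat [Finite ι] [P.IsReduced] [Module.Free ℤ X] {lam : X}
    (hlam : ∀ i ∈ b.support, 0 ≤ pair P lam i) (h : ℕ → P.weylGroup → WeightField X)
    (hc : ∀ n, Compat b 0 (h n)) (h1 : ∀ n, h n 1 = fexp lam ^ n) :
    hallLittlewood b lam = ∑ w ∈ (Set.toFinite (minReps b lam)).toFinset,
      tvar X ^ (dimFlag b lam - len b w) * h 1 w := by
  classical
  have := Fintype.ofFinite P.weylGroup
  set F := (Set.toFinite (minReps b lam)).toFinset with hF
  have hmem : ∀ w, w ∈ F ↔ w ∈ minReps b lam := fun w ↦ by simp [hF]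
  choose c hc1 hc2 hc3 using exists_coeff b lam
  simp only [finsum_eq_sum_of_fintype] at hc1
  set A : P.weylGroup → WeightField X :=
    fun v ↦ ∑ w ∈ F, tvar X ^ (dimFlag b lam - len b w) * c w v with hA
  have hS : ∀ n, ∑ w ∈ F, tvar X ^ (dimFlag b lam - len b w) * h n w =
      ∑ v, A v * fexp (v • lam) ^ n := by
    intro n
    simp only [hA, Finset.sum_mul]
    rw [Finset.sum_comm]
    refine Finset.sum_congr rfl fun w _ ↦ ?_
    rw [hc1 w n (h n) (hc n) (h1 n), Finset.mul_sum]
    exact Finset.sum_congr rfl fun v _ ↦ by ring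
  set a : X → WeightField X := fun μ ↦ ∑ v with v • lam = μ, A v with ha
  -- invariance of the coefficients
  have hainv : ∀ (u : P.weylGroup) (μ : X), a (u • μ) = actField u (a μ) := by
    intro u μ
    have h2 : ∀ n : ℕ, ∑ v, (A v - actField u (A (u⁻¹ * v))) * fexp (v • lam) ^ n = 0 := by
      intro n
      have h3 := (hc n).actField_sum_minReps hlam (h1 n) u
      rw [hS n, map_sum] at h3
      simp only [sub_mul, Finset.sum_sub_distrib]
      rw [sub_eq_zero, ← h3]
      refine Fintype.sum_equiv (Equiv.mulLeft u) _ _ fun v ↦ ?_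
      rw [Equiv.coe_mulLeft, inv_mul_cancel_left, map_mul, map_pow, actField_fexp, mul_smul]
    have h4 := sum_filter_eq_zero_of_forall_pow _ _ h2 (fexp (u • μ))
    simp only [fexp_injective.eq_iff, Finset.sum_sub_distrib, sub_eq_zero] at h4
    rw [ha]
    beta_reduce
    rw [h4, map_sum]
    refine Finset.sum_nbij' (fun v ↦ u⁻¹ * v) (fun v ↦ u * v) ?_ ?_ ?_ ?_ ?_
    · intro v hv
      simp only [Finset.mem_filter, Finset.mem_univ, true_and] at hv ⊢
      rw [mul_smul, hv, inv_smul_smul]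
    · intro v hv
      simp only [Finset.mem_filter, Finset.mem_univ, true_and] at hv ⊢
      rw [mul_smul, hv]
    · intro v _
      simp
    · intro v _
      simp
    · intro v _
      rfl
  -- the coefficient at the longest element of `W^λ`
  obtain ⟨m, hm, hmneg⟩ := exists_longest_minRep hlam
  have hlenm : len b m = dimFlag b lam := le_antisymm (len_le_dimFlag hlam hm)
    (dimFlag_le_len hlam fun i hi ↦ hmneg i ((mem_outerFinset hlam).1 hi).2)
  have hcm : ∀ w ∈ F, ∀ v, v • lam = m • lam → c w v ≠ 0 → w = m ∧ v = m := by
    intro w hw v hv hne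
    have h2 : dimFlag b lam ≤ len b v := by
      refine dimFlag_le_len hlam fun i hi h3 ↦ ?_
      have h4 := pair_smul_of_smul_eq hv i
      have h5 := hmneg _ (h4 ▸ ((mem_outerFinset hlam).1 hi).2)
      rw [smul_inv_smul] at h5
      exact h5 h3
    have h3 := len_le_dimFlag hlam ((hmem w).1 hw)
    rcases hc3 w v hne with rfl | h4
    · have := eq_of_mem_minReps hlam ((hmem v).1 hw) hm hv
      exact ⟨this, this⟩
    · omega
  have ham : a (m • lam) = actField m (∏ i ∈ outerFinset b lam, cfac P i) := by
    have h2 : a (m • lam) = c m m := by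
      simp only [ha, hA]
      rw [Finset.sum_eq_single m, Finset.sum_eq_single m]
      · rw [hlenm, Nat.sub_self, pow_zero, one_mul]
      · intro w hw hne
        by_cases h3 : c w m = 0
        · rw [h3, mul_zero]
        · exact absurd (hcm w hw m rfl h3).1 hne
      · exact fun h' ↦ absurd ((hmem m).2 hm) h'
      · intro v hv hne
        refine Finset.sum_eq_zero fun w hw ↦ ?_
        by_cases h3 : c w v = 0
        · rw [h3, mul_zero]
        · exact absurd (hcm w hw v (Finset.mem_filter.1 hv).2 h3).2 hne
      · exact fun h' ↦ absurd (by simp) h'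
    rw [h2, hc2, map_prod]
    refine Finset.prod_nbij' (fun i ↦ negIdx P (m⁻¹ • i)) (fun i ↦ negIdx P (m • i)) ?_ ?_ ?_ ?_ ?_
    · intro i hi
      obtain ⟨h3, h4⟩ := mem_inversions.1 hi
      have h5 := (isPos_negIdx b _).2 h4
      refine (mem_outerFinset hlam).2 ⟨h5, lt_of_le_of_ne (pair_nonneg hlam h5) fun h0 ↦ ?_⟩
      have := isPos_smul_of_pair_eq_zero hlam ((mem_minReps_iff hlam).1 hm) h5 h0.symm
      rw [smul_negIdx, smul_inv_smul, isPos_negIdx] at this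
      exact this h3
    · intro i hi
      have h3 := (mem_outerFinset hlam).1 hi
      refine mem_inversions.2 ⟨(isPos_negIdx b _).2 (hmneg i h3.2), ?_⟩
      rw [smul_negIdx, inv_smul_smul, isPos_negIdx, not_not]
      exact h3.1
    · intro i _
      simp only [smul_negIdx, smul_inv_smul, negIdx_negIdx]
    · intro i _
      simp only [smul_negIdx, inv_smul_smul, negIdx_negIdx]
    · intro i _
      rw [actField_cfac, smul_negIdx, smul_inv_smul]
  have halam : a lam = ∏ i ∈ outerFinset b lam, cfac P i := by
    rw [hainv] at ham
    exact (actField m).injective ham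
  -- both sides are grouped by the weight `w λ`, `w ∈ W^λ`, and compared term by term
  choose rep hrep hrep' using exists_mem_minReps_smul_eq b lam
  have h2 := hS 1
  have h5 := Finset.sum_fiberwise_of_maps_to (s := Finset.univ) (g := rep) (t := F)
    (fun v _ ↦ (hmem _).2 (hrep v)) fun v ↦ A v * fexp (v • lam) ^ 1
  rw [h2, hallLittlewood_eq_sum, ← h5]
  refine Finset.sum_congr rfl fun w hw ↦ ?_
  have h3 : ∀ v, rep v = w ↔ v • lam = w • lam := fun v ↦
    ⟨fun h4 ↦ by rw [← hrep' v, h4], fun h4 ↦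
      eq_of_mem_minReps hlam (hrep v) ((hmem w).1 hw) ((hrep' v).trans h4)⟩
  simp only [h3]
  rw [map_mul, ← halam, ← hainv, actField_fexp, mul_comm, ha, Finset.sum_mul]
  refine Finset.sum_congr rfl fun v hv ↦ ?_
  rw [(Finset.mem_filter.1 hv).2, pow_one]

/-! ### Expansion of the product over the path -/

lemma BruhatPath.append_iff {u w : P.weylGroup} {L : List ι} {i : ι} :
    BruhatPath b u (L ++ [i]) w ↔
      BruhatPath b u L (w * refl P i) ∧ BruhatLT b (w * refl P i) w := by
  induction L generalizing u with
  | nil =>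
    simp only [List.nil_append, BruhatPath]
    constructor
    · rintro ⟨h1, rfl⟩
      rw [mul_refl_mul_refl]
      exact ⟨rfl, h1⟩
    · rintro ⟨rfl, h1⟩
      rw [mul_refl_mul_refl]
      exact ⟨h1, rfl⟩
  | cons j L ih =>
    simp only [List.cons_append, BruhatPath, ih]
    tauto

lemma BruhatPath.len_add_length_le {u w : P.weylGroup} {L : List ι} (h : BruhatPath b u L w) :
    len b u + L.length ≤ len b w := by
  induction L generalizing u with
  | nil => rw [show u = w from h]; simp
  | cons j L ih =>
    have h1 := ih h.2
    have h2 := h.1.len_lt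
    rw [List.length_cons]
    omega

lemma BruhatPath.len_add_length_mod_two [Finite ι] [P.IsReduced] {u w : P.weylGroup} {L : List ι}
    (h : BruhatPath b u L w) : (len b u + L.length) % 2 = len b w % 2 := by
  induction L generalizing u with
  | nil => rw [show u = w from h]; simp
  | cons j L ih =>
    have h1 := ih h.2
    have h2 := len_mul_refl_mod_two (b := b) j u
    rw [List.length_cons]
    omega

lemma affineRefl_eq (i : ι) (d : ℤ) (μ : X) :
    affineRefl P i d μ = refl P i • μ + d • P.root i := rfl

lemma BruhatPath.smul_foldr {l : ℕ} {β : Fin l → ι} (d : Fin l → ℤ) {L : List (Fin l)}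
    {u w : P.weylGroup} (h : BruhatPath b u (L.map β) w) (μ : X) :
    u • L.foldr (fun j ν ↦ affineRefl P (β j) (d j) ν) μ =
      w • μ + u • L.foldr (fun j ν ↦ affineRefl P (β j) (d j) ν) 0 := by
  induction L generalizing u with
  | nil => rw [show u = w from h]; simp
  | cons j L ih =>
    rw [List.foldr_cons, List.foldr_cons, affineRefl_eq, affineRefl_eq, smul_add, smul_add,
      ← mul_smul, ← mul_smul, ih h.2, add_assoc]

lemma BruhatPath.smul_rHat {l : ℕ} {β : Fin l → ι} (d : Fin l → ℤ) {J : Finset (Fin l)}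
    {u w : P.weylGroup} (h : BruhatPath b u ((J.sort (· ≤ ·)).map β) w) (μ : X) :
    u • rHat P β d J μ = w • μ + u • rHat P β d J 0 :=
  h.smul_foldr d μ

lemma sort_map_castSucc {l : ℕ} (J : Finset (Fin l)) :
    (J.map Fin.castSuccEmb).sort (· ≤ ·) = (J.sort (· ≤ ·)).map Fin.castSucc :=
  (Finset.map_sort Fin.castSuccEmb J (· ≤ ·) (· ≤ ·) fun _ _ _ _ ↦ Iff.rfl).symm

lemma sort_insert_last {l : ℕ} (J : Finset (Fin l)) :
    (insert (Fin.last l) (J.map Fin.castSuccEmb)).sort (· ≤ ·) =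
      (J.sort (· ≤ ·)).map Fin.castSucc ++ [Fin.last l] := by
  classical
  have h1 : ((J.sort (· ≤ ·)).map Fin.castSucc ++ [Fin.last l]).toFinset =
      insert (Fin.last l) (J.map Fin.castSuccEmb) := by
    ext j
    simp
  rw [← h1, List.toFinset_sort]
  · refine List.pairwise_append.2 ⟨List.pairwise_map.2 (J.pairwise_sort (· ≤ ·)),
      List.pairwise_singleton _ _, fun a _ c hc ↦ ?_⟩
    rw [List.mem_singleton.1 hc]
    exact Fin.le_last a
  · refine List.Nodup.append ((J.sort_nodup _).map (Fin.castSucc_injective l))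
      (List.nodup_singleton _) ?_
    simp [List.disjoint_singleton]

lemma sum_finset_fin_succ {M : Type*} [AddCommMonoid M] {l : ℕ} (g : Finset (Fin (l + 1)) → M) :
    ∑ J, g J = ∑ J : Finset (Fin l), g (J.map Fin.castSuccEmb) +
      ∑ J : Finset (Fin l), g (insert (Fin.last l) (J.map Fin.castSuccEmb)) := by
  classical
  rw [← Finset.powerset_univ, Fin.univ_castSuccEmb, Finset.cons_eq_insert,
    Finset.sum_powerset_insert (by simp), Finset.map_eq_image, Finset.powerset_image,
    Finset.sum_image, Finset.sum_image, Finset.powerset_univ]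
  · simp only [Finset.map_eq_image]
  all_goals
    intro J _ J' _ hJ
    exact Finset.image_injective Fin.castSuccEmb.injective hJ

lemma card_insert_last {l : ℕ} (J : Finset (Fin l)) :
    (insert (Fin.last l) (J.map Fin.castSuccEmb)).card = J.card + 1 := by
  rw [Finset.card_insert_of_notMem (by simp), Finset.card_map]

open Classical in
/-- The product over the path, applied to the constant family: the sum over all `J`, the set of
steps at which the path is folded. -/
theorem pathProd_one_eq_sum [Finite ι] [P.IsReduced] [Fintype P.weylGroup] {l : ℕ}
    {β : Fin l → ι} (d : Fin l → ℤ) (hpos : ∀ j, b.IsPos (β j)) (w : P.weylGroup) :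
    pathProd b l β d 1 w = ∑ J : Finset (Fin l), ∑ u : P.weylGroup,
      if BruhatPath b u ((J.sort (· ≤ ·)).map β) w then
        tvar X ^ ((len b w - len b u - J.card) / 2) * (1 - tvar X) ^ J.card *
          fexp (u • rHat P β d J 0)
      else 0 := by
  induction l generalizing w with
  | zero =>
    rw [Fintype.sum_unique, show (default : Finset (Fin 0)) = ∅ from rfl]
    simp [pathProd, BruhatPath, rHat]
  | succ l ih =>
    have hβ := hpos (Fin.last l)
    rw [pathProd, sum_finset_fin_succ, pathStep]
    congr 1
    · rw [ih (β := fun j ↦ β j.castSucc) (fun j ↦ d j.castSucc) fun j ↦ hpos _]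
      simp only [sort_map_castSucc, Finset.card_map, rHat, List.foldr_map, List.map_map]
      rfl
    · have hlt : BruhatLT b (w * refl P (β (Fin.last l))) w ↔ ¬ b.IsPos (w • β (Fin.last l)) := by
        have := bruhatLT_mul_refl_iff hβ (u := w * refl P (β (Fin.last l)))
        rwa [mul_refl_mul_refl, isPos_smul_refl_self] at this
      simp only [sort_insert_last, card_insert_last, List.map_append, List.map_map, List.map_cons,
        List.map_nil, BruhatPath.append_iff, hlt]
      split_ifs with hw
      · simp [hw]
      · rw [ih (β := fun j ↦ β j.castSucc) (fun j ↦ d j.castSucc) fun j ↦ hpos _, Finset.mul_sum]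
        refine Finset.sum_congr rfl fun J _ ↦ ?_
        rw [Finset.mul_sum]
        refine Finset.sum_congr rfl fun u _ ↦ ?_
        simp only [hw, not_false_eq_true, and_true]
        change _ * (if BruhatPath b u ((J.sort (· ≤ ·)).map fun j ↦ β j.castSucc)
            (w * refl P (β (Fin.last l))) then _ else _) =
          if BruhatPath b u ((J.sort (· ≤ ·)).map fun j ↦ β j.castSucc)
            (w * refl P (β (Fin.last l))) then _ else _
        split_ifs with hu
        · have h1 := hu.len_add_length_le
          have h2 := hu.len_add_length_mod_two
          rw [List.length_map, Finset.length_sort] at h1 h2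
          have h3 := (hlt.2 hw).len_lt
          have h4 := len_mul_refl_mod_two (b := b) (β (Fin.last l)) w
          have h5 : (len b w - len b u - (J.card + 1)) / 2 =
              (len b w - len b (w * refl P (β (Fin.last l))) - 1) / 2 +
                (len b (w * refl P (β (Fin.last l))) - len b u - J.card) / 2 := by
            omega
          have h6 : u • rHat P β d (insert (Fin.last l) (J.map Fin.castSuccEmb)) 0 =
              -(d (Fin.last l) • P.root (w • β (Fin.last l))) +
                u • rHat P (fun j ↦ β j.castSucc) (fun j ↦ d j.castSucc) J 0 := by
            have h7 := hu.smul_rHat (fun j ↦ d j.castSucc) (d (Fin.last l) • P.root (β (Fin.last l)))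
            have h8 : (w * refl P (β (Fin.last l))) • d (Fin.last l) • P.root (β (Fin.last l)) =
                -(d (Fin.last l) • P.root (w • β (Fin.last l))) := by
              rw [smul_zsmul_weight, ← root_smul, mul_smul, refl_smul_self, smul_negIdx,
                root_negIdx, smul_neg]
            rw [← h8, ← h7]
            simp only [rHat, sort_insert_last, List.foldr_append, List.foldr_map, List.foldr_cons,
              List.foldr_nil, affineRefl_eq (β (Fin.last l)), smul_zero, zero_add]
          rw [h5, h6, fexp_add, pow_add, pow_succ]
          ring
        · rw [mul_zero]

end

end HallLittlewood

end

open HallLittlewood in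
theorem proposition8p8 {ι X Y : Type*} [Finite ι] [AddCommGroup X] [Module.Free ℤ X]
    [Module.Finite ℤ X] [AddCommGroup Y] (P : RootDatum ι X Y) [P.IsReduced] (b : P.Base)
    (lam : X) (hlam : ∀ i ∈ b.support, 0 ≤ P.toLinearMap lam (P.coroot i))
    {l : ℕ} (β : Fin l → ι) (d : Fin l → ℤ)
    (hΓ : IsReducedChain b (-lam) (fun j ↦ negIdx P (β j)) d) :
    (∀ p ∈ admissibleOp b lam β,
      2 * (tExponent b lam p : ℤ) =
        2 * dimFlag b lam - len b p.2.2 - len b p.1 - p.2.1.card) ∧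
    hallLittlewood b lam =
      algebraMap (WeightRing X) (WeightField X)
        (∑ p ∈ (Set.toFinite (admissibleOp b lam β)).toFinset,
          Polynomial.X ^ tExponent b lam p * (1 - Polynomial.X) ^ p.2.1.card *
            expo (p.1 • rHat P β d p.2.1 lam)) := by
  classical
  have := Fintype.ofFinite P.weylGroup
  have hexp : ∀ p ∈ admissibleOp b lam β, len b p.2.2 ≤ dimFlag b lam ∧
      len b p.1 + p.2.1.card ≤ len b p.2.2 ∧
      (len b p.1 + p.2.1.card) % 2 = len b p.2.2 % 2 := by
    rintro ⟨u, J, w⟩ ⟨hw, hp⟩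
    have h1 := hp.len_add_length_le
    have h2 := hp.len_add_length_mod_two
    rw [List.length_map, Finset.length_sort] at h1 h2
    exact ⟨len_le_dimFlag hlam hw, h1, h2⟩
  refine ⟨fun p hp ↦ ?_, ?_⟩
  · obtain ⟨h1, h2, h3⟩ := hexp p hp
    rw [tExponent]
    omega
  obtain ⟨K, hK⟩ := hΓ.exists_floorPath hlam
  -- the operator that raises the initial value `x^{nλ}` to `x^{(n+1)λ}`
  set Φ : (P.weylGroup → WeightField X) → P.weylGroup → WeightField X :=
    fun f w ↦ fexp (w • lam) * pathProd b l β d f w with hΦ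
  have hΦc : ∀ f, Compat b 0 f → Compat b 0 (Φ f) := by
    intro f hf
    have h1 : Compat b (K 0) f := hf.congr fun i hi ↦ by
      rw [hK.zero, fundFloor, if_pos hi]
      rfl
    refine ((h1.pathProd hK.neg hK.pos hK.step hK.refl).congr fun i hi ↦ ?_).twist
    rw [hK.last, fundFloor, if_pos hi, zero_add]
  have hΦ1 : ∀ f, Φ f 1 = fexp lam * f 1 := fun f ↦ by
    simp only [hΦ, one_smul, pathProd_apply_one d hK.pos]
  rw [hallLittlewood_eq_sum_compat hlam (fun n ↦ Φ^[n] 1)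
    (fun n ↦ Function.Iterate.rec _ compat_one hΦc n) fun n ↦ ?_]
  swap
  · induction n with
    | zero => simp
    | succ n ih => rw [Function.iterate_succ_apply', hΦ1, ih, pow_succ']
  simp only [Function.iterate_one, hΦ]
  have hR : (Set.toFinite (admissibleOp b lam β)).toFinset =
      Finset.univ.filter (· ∈ admissibleOp b lam β) := by
    ext p
    simp
  have hF : (Set.toFinite (minReps b lam)).toFinset =
      Finset.univ.filter (· ∈ minReps b lam) := by
    ext p
    simp
  rw [map_sum, hR, hF, Finset.sum_filter, Finset.sum_filter, Fintype.sum_prod_type,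
    Finset.sum_comm, Fintype.sum_prod_type, Finset.sum_comm]
  refine Finset.sum_congr rfl fun w _ ↦ ?_
  split_ifs with hw
  · rw [pathProd_one_eq_sum d hK.pos, Finset.mul_sum, Finset.mul_sum]
    refine Finset.sum_congr rfl fun J _ ↦ ?_
    rw [Finset.mul_sum, Finset.mul_sum]
    refine Finset.sum_congr rfl fun u _ ↦ ?_
    by_cases hp : BruhatPath b u ((J.sort (· ≤ ·)).map β) w
    · have hadm : (u, J, w) ∈ admissibleOp b lam β := ⟨hw, hp⟩
      obtain ⟨h1, h2, h3⟩ := hexp _ hadm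
      rw [if_pos hp, if_pos hadm, hp.smul_rHat d lam]
      have h4 : tExponent b lam (u, J, w) =
          dimFlag b lam - len b w + (len b w - len b u - J.card) / 2 := by
        rw [tExponent]
        simp only at h1 h2 h3 ⊢
        omega
      rw [h4, expo_add, pow_add]
      simp only [map_mul, map_pow, map_sub, map_one]
      change tvar X ^ _ * (fexp _ * (_ * _ * fexp _)) =
        tvar X ^ _ * tvar X ^ _ * (1 - tvar X) ^ _ * (fexp _ * fexp _)
      ring
    · rw [if_neg hp, if_neg fun h ↦ hp h.2, mul_zero, mul_zero]
  · refine (Finset.sum_eq_zero fun J _ ↦ Finset.sum_eq_zero fun u _ ↦ if_neg fun h ↦ hw h.1).symm
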